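/- Let $(\mathcal A,\varphi)$ be a tracial $*$-noncommutative probability space: $\mathcal A$ is a complex unital $*$-algebra and $\varphi:\mathcal A\to\mathbb C$ is linear with $\varphi(1)=1$, $\varphi(a^*a)\ge 0$ and $\varphi(ab)=\varphi(ba)$ for all $a,b\in\mathcal A$. Let $p_1,\dots,p_d\in\mathcal A$ be self-adjoint pairwise orthogonal projections with $p_1+\cdots+p_d=1$ and $\rho_k:=\varphi(p_k)\neq 0$ for every $k$. Put $\mathcal D=\operatorname{Span}\{p_1,\dots,p_d\}$ and let $E:\mathcal A\to\mathcal D$ be the conditional expectation $E(x)=\sum_{k=1}^d\rho_k^{-1}\varphi(p_kxp_k)\,p_k$. Subalgebras are unital. A family $(\mathcal A_i)_{i\in I}$ of subalgebras is $\varphi$-free if $\varphi(x_1\cdots x_n)=0$ for all $n\ge1$, all $i_1\ne i_2\ne\cdots\ne i_n$ (consecutive indices distinct) and all $x_k\in\mathcal A_{i_k}\cap\ker\varphi$. A family of subalgebras that all contain $\mathcal D$ is free with amalgamation over $\mathcal D$ if the same holds with $E$ in place of $\varphi$. A family $(\chi_i)_{i\in I}$ of subsets of $\mathcal A$ is $\varphi$-free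 (resp. free with amalgamation over $\mathcal D$) if there is a family $(\mathcal A_i)_{i\in I}$ of subalgebras with this property such that $\chi_i\subset\mathcal A_i$ for all $i$. An element $y$ is $\varphi$-semicircular if $y=y^*$ and $\varphi(y^n)=\frac1{2\pi}\int_{-2}^2x^n\sqrt{4-x^2}\,dx$ for all $n\ge0$. Let $(c_n)_{n\ge1}$ be the $\mathcal D$-valued cumulants, i.e. the $\mathcal D$-bimodule maps $c_n:\mathcal A^{\otimes_{\mathcal D}n}\to\mathcal D$ determined by $E(a_1\cdots a_n)=\sum_{\pi}c_\pi(a_1\otimes\cdots\otimes a_n)$, where $\pi$ runs over the noncrossing partitions of $\{1,\dots,n\}$ and $c_\pi$ is obtained by nesting the maps $c_m$ according to the blocks of $\pi$ (for example, for $\pi=\{\{1,4\},\{2,3\},\{5\}\}$, $c_\pi(a_1\otimes\cdots\otimes a_5)=c_2(a_1c_2(a_2\otimes a_3)\otimes a_4)\,c_1(a_5)$). A self-adjoint $X\in\mathcal A$ is $\mathcal D$-semicircular with covariance $\varphi$ if $c_1(X)=0$, $c_2(X\delta\otimes X)=\varphi(\delta)1$ for all $\delta\in\mathcal D$, and $c_k(X\delta_1\otimes\cdots\otimes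 X\delta_k)=0$ for all $k\ge3$ and $\delta_1,\dots,\delta_k\in\mathcal D$. **Theorem.** Let $(y(s))_{s\in\mathbb N}$ be a family of $\varphi$-semicircular elements of $\mathcal A$ and let $\mathcal B$ be a subalgebra of $\mathcal A$ containing $\mathcal D$ such that the family of subsets $(\mathcal B,(\{y(s)\})_{s\in\mathbb N})$ is $\varphi$-free. Then the family $(\mathcal B,(\{y(s)\})_{s\in\mathbb N})$ is also free with amalgamation over $\mathcal D$, and each $y(s)$ is $\mathcal D$-semicircular with covariance $\varphi$. -/

import Mathlib

open scoped ComplexOrder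

noncomputable section

namespace RectFree

variable {A : Type*} [Ring A] [Algebra ℂ A]

/-- `φ` is a tracial state on the complex unital `*`-algebra `A`, that is, `(A, φ)` is a tracial
`*`-noncommutative probability space. -/
structure IsTracialState [StarRing A] (φ : A →ₗ[ℂ] ℂ) : Prop where
  map_one : φ 1 = 1
  nonneg : ∀ a : A, 0 ≤ φ (star a * a)
  trace : ∀ a b : A, φ (a * b) = φ (b * a)

/-- The linear span `𝒟` of the projections `p₁, …, p_d`. -/
def diag {d : ℕ} (p : Fin d → A) : Submodule ℂ A :=
  Submodule.span ℂ (Set.range p)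

/-- The map `E(x) = ∑ₖ φₖ(pₖ x pₖ) pₖ`, where `φₖ = φ / φ(pₖ)`. -/
def condExp (φ : A →ₗ[ℂ] ℂ) {d : ℕ} (p : Fin d → A) : A →ₗ[ℂ] A where
  toFun x := ∑ k, ((φ (p k))⁻¹ * φ (p k * x * p k)) • p k
  map_add' x y := by
    simp only [mul_add, add_mul, map_add, add_smul, Finset.sum_add_distrib]
  map_smul' c x := by
    simp only [mul_smul_comm, smul_mul_assoc, map_smul, smul_eq_mul, RingHom.id_apply,
      Finset.smul_sum, smul_smul]
    exact Finset.sum_congr rfl fun k _ => by ring_nf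

/-- Vanishing of `T` on all alternating products of elements of the algebras of the family that
lie in the kernel of `T`. For `T = φ` this is freeness of the subalgebras, and for `T = E` (when
all of them contain `𝒟`) this is freeness with amalgamation over `𝒟`. -/
def AlternatingVanish {M : Type*} [AddCommGroup M] [Module ℂ M] (T : A →ₗ[ℂ] M)
    {I : Type*} (F : I → Subalgebra ℂ A) : Prop :=
  ∀ (n : ℕ) (i : Fin (n + 1) → I), (∀ k : Fin n, i k.castSucc ≠ i k.succ) →
    ∀ x : Fin (n + 1) → A, (∀ k, x k ∈ F (i k) ∧ T (x k) = 0) → T (List.ofFn x).prod = 0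

/-- A family of subsets of `A` is `φ`-free: it is contained in a `φ`-free family of
(unital) subalgebras. -/
def IsFree (φ : A →ₗ[ℂ] ℂ) {I : Type*} (χ : I → Set A) : Prop :=
  ∃ F : I → Subalgebra ℂ A, (∀ i, χ i ⊆ F i) ∧ AlternatingVanish φ F

/-- A family of subsets of `A` is free with amalgamation over `𝒟`. -/
def IsFreeOver (φ : A →ₗ[ℂ] ℂ) {d : ℕ} (p : Fin d → A) {I : Type*} (χ : I → Set A) : Prop :=
  ∃ F : I → Subalgebra ℂ A, (∀ i, diag p ≤ Subalgebra.toSubmodule (F i)) ∧ (∀ i, χ i ⊆ F i) ∧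
    AlternatingVanish (condExp φ p) F

/-- A `φ`-semicircular element: self-adjoint, with the moments of the semicircle distribution
with center `0` and radius `2`. -/
def IsSemicircular [StarRing A] (φ : A →ₗ[ℂ] ℂ) (y : A) : Prop :=
  IsSelfAdjoint y ∧ ∀ n : ℕ,
    φ (y ^ n) = ((∫ x in (-2 : ℝ)..2, x ^ n * (√(4 - x ^ 2) / (2 * Real.pi)) : ℝ) : ℂ)

/-! ### Noncrossing partitions and cumulants -/

/-- `π` is a noncrossing partition of `{0, …, n - 1}`. -/
def IsNoncrossing {n : ℕ} (π : Finpartition (Finset.univ : Finset (Fin n))) : Prop :=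
  ∀ i j k l : Fin n, i < j → j < k → k < l → k ∈ π.part i → l ∈ π.part j → j ∈ π.part i

/-- The elements of `s` that lie strictly between `v` and the next element of `V` (empty if `v` is
not followed by an element of `V`). -/
def gap {n : ℕ} (s V : Finset (Fin n)) (v : Fin n) : Finset (Fin n) :=
  s.filter fun x => v < x ∧ (∃ w ∈ V, x < w) ∧ ∀ w ∈ V, v < w → x < w

/-- The elements of `s` that lie after all elements of `V`. -/
def tail {n : ℕ} (s V : Finset (Fin n)) : Finset (Fin n) :=
  s.filter fun x => ∀ w ∈ V, w < x

/-- The nested evaluation `f_π` on the positions in `s` (`s` being a union of blocks of `π`), for a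
sequence `f` of functions of `m = 1, 2, …` arguments. If `V = {v₁ < ⋯ < vₘ}` is the block of the
first element of `s`, the value is
`f_m(a_{v₁} f_π(gap after v₁), …, a_{vₘ₋₁} f_π(gap after vₘ₋₁), a_{vₘ}) f_π(elements after vₘ)`,
and it is `1` on no positions. For example `π = {{1,6,8},{2,5},{3,4},{7},{9}}` gives
`f₃(a₁ f₂(a₂ f₂(a₃, a₄), a₅), a₆ f₁(a₇), a₈) f₁(a₉)`. -/
def nest (f : (m : ℕ) → (Fin m → A) → A) {n : ℕ}
    (π : Finpartition (Finset.univ : Finset (Fin n))) (a : Fin n → A) (s : Finset (Fin n)) : A :=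
  if hs : s.Nonempty then
    let V := s ∩ π.part (s.min' hs)
    f V.card (fun j => a (V.orderEmbOfFin rfl j) * nest f π a (gap s V (V.orderEmbOfFin rfl j))) *
      nest f π a (tail s V)
  else 1
termination_by s.card
decreasing_by
  · refine Finset.card_lt_card (Finset.filter_ssubset.2 ⟨_, Finset.min'_mem s hs, ?_⟩)
    rintro ⟨h, -⟩
    exact absurd h (not_lt.2 (Finset.min'_le s _
      (Finset.mem_inter.1 (Finset.orderEmbOfFin_mem _ rfl j)).1))
  · refine Finset.card_lt_card (Finset.filter_ssubset.2 ⟨_, Finset.min'_mem s hs, ?_⟩)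
    intro h
    exact lt_irrefl _ (h _ (Finset.mem_inter.2
      ⟨Finset.min'_mem s hs, Finpartition.mem_part _ (Finset.mem_univ _)⟩))

open Classical in
/-- The cumulant `c_n(a₁ ⊗ ⋯ ⊗ aₙ)` with respect to the conditional expectation `E`, defined by the
moment-cumulant formula `E(a₁ ⋯ aₙ) = ∑_{π ∈ NC(n)} c_π(a₁ ⊗ ⋯ ⊗ aₙ)`, in which the one-block
partition contributes `c_n(a₁ ⊗ ⋯ ⊗ aₙ)` and all others only involve `c_m` with `m < n`. -/
def cumulant (E : A →ₗ[ℂ] A) (n : ℕ) (a : Fin n → A) : A :=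
  E (List.ofFn a).prod -
    ∑ π : Finpartition (Finset.univ : Finset (Fin n)) with
        IsNoncrossing π ∧ Finset.univ ∉ π.parts,
      nest (fun m b => if _h : m < n then cumulant E m b else 0) π a Finset.univ
termination_by n

/-- `X` is `𝒟`-semicircular with covariance `φ`. -/
structure IsDSemicircular [StarRing A] (φ : A →ₗ[ℂ] ℂ) {d : ℕ} (p : Fin d → A) (X : A) :
    Prop where
  selfAdjoint : IsSelfAdjoint X
  first : cumulant (condExp φ p) 1 ![X] = 0
  second : ∀ δ ∈ diag p, cumulant (condExp φ p) 2 ![X * δ, X] = algebraMap ℂ A (φ δ)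
  higher : ∀ k, 3 ≤ k → ∀ δ : Fin k → A, (∀ j, δ j ∈ diag p) →
    cumulant (condExp φ p) k (fun j => X * δ j) = 0

end RectFree

end

/-! Write `E` for `condExp φ p` and `𝒟` for `diag p`. By traciality, `E x = 0` exactly when `φ (δ *
x) = 0` for every `δ ∈ 𝒟` (`condExp_eq_zero_iff`). So `E` vanishes on any space that is stable under
left multiplication by `𝒟` and killed by `φ`, and both claims reduce to rewriting elements as
`φ`-alternating words.

Freeness over `𝒟`: given a `φ`-free family `F` with `𝒟` inside `F none`, enlarge every `F i` to `𝒟 ⊔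
F i`. Repeated centering writes an element of `𝒟 ⊔ F (some s)` as an element of `𝒟` plus a left
`𝒟`-combination of words `u₁ δ₁ ⋯ uᵣ δᵣ` with all `uₖ`, and all `δₖ` but the last, centered
(`sup_le_diag_sup_centeredSpan`). If `E` kills the element, the `𝒟`-part is zero. An alternating
product of such elements then lies in `wordSpace`, which `E` annihilates.

Semicircularity: for `X = y s`, the Chebyshev polynomials `Uₘ(X)`, `m ≥ 1`, are `φ`-centered. They
give Wick-type elements that are sums of alternating words and in which `Xδ₀ ⋯ Xδₙ₋₁` expands with
constant term `S 0 n`, the sum over noncrossing pairings. Hence `E(Xδ₀ ⋯ Xδₙ₋₁) = S 0 n`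
(`condExp_word`). On the other side, the nested evaluations of any functionals with semicircular
values, summed over noncrossing partitions, satisfy the same pairing recursion: split off the block
of the first point (`IsSemicircularCumulant.isPairingSum`). Comparing the two by strong induction on
the order identifies the cumulants. -/

noncomputable section

namespace RectFree

/-! ### Alternating words and their spans -/

section Words

variable {A : Type*} [Ring A] [Algebra ℂ A] {M : Type*} [AddCommGroup M] [Module ℂ M] {I : Type*}

/-- `AltWord T F i w`: the element `w` is a nonempty alternating product of elements of the
algebras of the family `F` that lie in the kernel of `T`, the leftmost factor being in `F i`. -/
inductive AltWord (T : A →ₗ[ℂ] M) (F : I → Subalgebra ℂ A) : I → A → Prop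
  | single {i : I} {x : A} (hx : x ∈ F i) (h0 : T x = 0) : AltWord T F i x
  | cons {i j : I} {x w : A} (hx : x ∈ F i) (h0 : T x = 0) (hij : i ≠ j)
      (hw : AltWord T F j w) : AltWord T F i (x * w)

theorem AltWord.exists_ofFn {T : A →ₗ[ℂ] M} {F : I → Subalgebra ℂ A} {i : I} {w : A}
    (h : AltWord T F i w) : ∃ (n : ℕ) (l : Fin (n + 1) → I) (x : Fin (n + 1) → A),
      l 0 = i ∧ (∀ k : Fin n, l k.castSucc ≠ l k.succ) ∧ (∀ k, x k ∈ F (l k) ∧ T (x k) = 0) ∧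
        (List.ofFn x).prod = w := by
  induction h with
  | @single i x hx h0 =>
    exact ⟨0, fun _ => i, fun _ => x, rfl, fun k => k.elim0, fun _ => ⟨hx, h0⟩, by simp⟩
  | @cons i j x w hx h0 hij _ ih =>
    obtain ⟨n, l, y, hl0, hl, hy, rfl⟩ := ih
    refine ⟨n + 1, Fin.cons i l, Fin.cons x y, rfl, ?_, ?_, by simp⟩
    · intro k
      refine Fin.cases ?_ (fun k => ?_) k
      · simpa [hl0] using hij
      · rw [← Fin.succ_castSucc, Fin.cons_succ, Fin.cons_succ]
        exact hl k
    · intro k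
      refine Fin.cases ?_ (fun k => ?_) k
      · exact ⟨hx, h0⟩
      · exact hy k

theorem AltWord.of_ofFn {T : A →ₗ[ℂ] M} {F : I → Subalgebra ℂ A} :
    ∀ (n : ℕ) (l : Fin (n + 1) → I) (x : Fin (n + 1) → A),
      (∀ k : Fin n, l k.castSucc ≠ l k.succ) → (∀ k, x k ∈ F (l k) ∧ T (x k) = 0) →
        AltWord T F (l 0) (List.ofFn x).prod
  | 0, l, x, _, hx => by
    simpa using AltWord.single (hx 0).1 (hx 0).2
  | n + 1, l, x, hl, hx => by
    rw [List.ofFn_succ, List.prod_cons]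
    refine AltWord.cons (hx 0).1 (hx 0).2 (hl 0)
      (AltWord.of_ofFn n (fun k => l k.succ) (fun k => x k.succ) (fun k => ?_) fun k => hx k.succ)
    have := hl k.succ
    rwa [← Fin.succ_castSucc] at this

theorem alternatingVanish_iff {T : A →ₗ[ℂ] M} {F : I → Subalgebra ℂ A} :
    AlternatingVanish T F ↔ ∀ i w, AltWord T F i w → T w = 0 := by
  refine ⟨fun h i w hw => ?_, fun h n l hl x hx => h _ _ (AltWord.of_ofFn n l x hl hx)⟩
  obtain ⟨n, l, x, -, hl, hx, rfl⟩ := hw.exists_ofFn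
  exact h n l hl x hx

/-- The span of the alternating words that begin in `F i`. -/
def altSpan (T : A →ₗ[ℂ] M) (F : I → Subalgebra ℂ A) (i : I) : Submodule ℂ A :=
  Submodule.span ℂ {w | AltWord T F i w}

theorem mem_altSpan_single {T : A →ₗ[ℂ] M} {F : I → Subalgebra ℂ A} {i : I} {x : A}
    (hx : x ∈ F i) (h0 : T x = 0) : x ∈ altSpan T F i :=
  Submodule.subset_span (AltWord.single hx h0)

theorem mul_mem_altSpan {T : A →ₗ[ℂ] M} {F : I → Subalgebra ℂ A} {i j : I} {x w : A}
    (hx : x ∈ F i) (h0 : T x = 0) (hij : i ≠ j) (hw : w ∈ altSpan T F j) :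
    x * w ∈ altSpan T F i := by
  induction hw using Submodule.span_induction with
  | mem w hw => exact Submodule.subset_span (AltWord.cons hx h0 hij hw)
  | zero => simp
  | add a b _ _ ha hb => rw [mul_add]; exact add_mem ha hb
  | smul c a _ ha => rw [mul_smul_comm]; exact Submodule.smul_mem _ _ ha

theorem AlternatingVanish.apply_altSpan {T : A →ₗ[ℂ] M} {F : I → Subalgebra ℂ A}
    (h : AlternatingVanish T F) {i : I} {w : A} (hw : w ∈ altSpan T F i) : T w = 0 := by
  have : altSpan T F i ≤ LinearMap.ker T :=
    Submodule.span_le.2 fun w hw => alternatingVanish_iff.1 h i w hw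
  exact this hw

end Words

/-! ### The algebra `𝒟` and its conditional expectation -/

section Diag

variable {A : Type*} [Ring A] [Algebra ℂ A] (φ : A →ₗ[ℂ] ℂ) {d : ℕ} {p : Fin d → A}

/-- The part of `x` of zero `φ`-expectation. -/
def center (x : A) : A := x - φ x • 1

variable {φ}

theorem apply_center (h1 : φ 1 = 1) (x : A) : φ (center φ x) = 0 := by
  simp [center, h1]

theorem center_mem {S : Subalgebra ℂ A} {x : A} (hx : x ∈ S) : center φ x ∈ S :=
  sub_mem hx (S.smul_mem (one_mem S) _)

theorem eq_add_center (x : A) : x = φ x • 1 + center φ x := by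
  simp [center]

theorem mem_diag (p : Fin d → A) (k : Fin d) : p k ∈ diag p :=
  Submodule.subset_span ⟨k, rfl⟩

theorem one_mem_diag (hp : CompleteOrthogonalIdempotents p) : (1 : A) ∈ diag p := by
  rw [← hp.complete]
  exact sum_mem fun k _ => mem_diag p k

theorem mul_mem_diag (hp : CompleteOrthogonalIdempotents p) {x y : A} (hx : x ∈ diag p)
    (hy : y ∈ diag p) : x * y ∈ diag p := by
  have h : diag p * diag p ≤ diag p := by
    rw [diag, Submodule.span_mul_span, Submodule.span_le]
    rintro _ ⟨_, ⟨i, rfl⟩, _, ⟨j, rfl⟩, rfl⟩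
    change p i * p j ∈ _
    rw [hp.mul_eq]
    split_ifs
    · exact mem_diag p i
    · exact zero_mem _
  exact h (Submodule.mul_mem_mul hx hy)

/-- The span of the projections as a subalgebra. -/
def diagAlg (hp : CompleteOrthogonalIdempotents p) : Subalgebra ℂ A :=
  (diag p).toSubalgebra (one_mem_diag hp) fun _ _ => mul_mem_diag hp

theorem condExp_eq (htr : ∀ a b, φ (a * b) = φ (b * a)) (hp : CompleteOrthogonalIdempotents p)
    (x : A) : condExp φ p x = ∑ k, ((φ (p k))⁻¹ * φ (p k * x)) • p k := by
  change ∑ k, ((φ (p k))⁻¹ * φ (p k * x * p k)) • p k = _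
  refine Finset.sum_congr rfl fun k _ => ?_
  rw [htr, ← mul_assoc, (hp.idem k).eq]

/-- Since `φ (p k * E x) = φ (p k * x)`, the functionals `φ (p k * ·)` see exactly the coefficients
of `E x`. This turns statements about `E` into statements about `φ`. -/
theorem condExp_eq_zero_iff (htr : ∀ a b, φ (a * b) = φ (b * a))
    (hp : CompleteOrthogonalIdempotents p) (hρ : ∀ k, φ (p k) ≠ 0) {x : A} :
    condExp φ p x = 0 ↔ ∀ δ ∈ diag p, φ (δ * x) = 0 := by
  constructor
  · intro h δ hδ
    have hk : ∀ k, φ (p k * x) = 0 := by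
      intro k
      have h2 : φ (p k * condExp φ p x) = φ (p k * x) := by
        rw [condExp_eq htr hp, Finset.mul_sum, map_sum, Finset.sum_eq_single k]
        · rw [mul_smul_comm, (hp.idem k).eq, map_smul, smul_eq_mul]
          field_simp [hρ k]
        · intro j _ hj
          rw [mul_smul_comm, hp.mul_eq, if_neg hj.symm, smul_zero, map_zero]
        · simp
      rw [← h2, h, mul_zero, map_zero]
    induction hδ using Submodule.span_induction with
    | mem _ h => obtain ⟨k, rfl⟩ := h; exact hk k
    | zero => simp
    | add a b _ _ ha hb => rw [add_mul, map_add, ha, hb, add_zero]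
    | smul c a _ ha => rw [smul_mul_assoc, map_smul, ha, smul_zero]
  · intro h
    rw [condExp_eq htr hp]
    exact Finset.sum_eq_zero fun k _ => by rw [h _ (mem_diag p k), mul_zero, zero_smul]

theorem condExp_of_mem (htr : ∀ a b, φ (a * b) = φ (b * a))
    (hp : CompleteOrthogonalIdempotents p) (hρ : ∀ k, φ (p k) ≠ 0) {x : A} (hx : x ∈ diag p) :
    condExp φ p x = x := by
  induction hx using Submodule.span_induction with
  | mem _ h =>
    obtain ⟨k, rfl⟩ := h
    rw [condExp_eq htr hp, Finset.sum_eq_single k]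
    · rw [(hp.idem k).eq, inv_mul_cancel₀ (hρ k), one_smul]
    · intro j _ hj
      rw [hp.mul_eq, if_neg hj, map_zero, mul_zero, zero_smul]
    · simp
  | zero => simp
  | add a b _ _ ha hb => rw [map_add, ha, hb]
  | smul c a _ ha => rw [map_smul, ha]

end Diag

/-! ### Reduction of `𝒟`-centered elements to `φ`-alternating words -/

section Amalgamation

variable {A : Type*} [Ring A] [Algebra ℂ A] {φ : A →ₗ[ℂ] ℂ} {I : Type*}
  {F : Option I → Subalgebra ℂ A} {D : Subalgebra ℂ A}

/-- Words `u₁ δ₁ u₂ δ₂ ⋯ uᵣ δᵣ`, `r ≥ 1`, with centered `uₖ ∈ C`, `δₖ ∈ D`, and `δₖ` centered for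
`k < r`. -/
inductive CenteredWord (φ : A →ₗ[ℂ] ℂ) (C D : Subalgebra ℂ A) : A → Prop
  | base {u δ : A} (hu : u ∈ C) (hu0 : φ u = 0) (hδ : δ ∈ D) : CenteredWord φ C D (u * δ)
  | step {u δ g : A} (hu : u ∈ C) (hu0 : φ u = 0) (hδ : δ ∈ D) (hδ0 : φ δ = 0)
      (hg : CenteredWord φ C D g) : CenteredWord φ C D (u * (δ * g))

/-- The left `D`-module spanned by the centered words. -/
def centeredSpan (φ : A →ₗ[ℂ] ℂ) (C D : Subalgebra ℂ A) : Submodule ℂ A :=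
  Subalgebra.toSubmodule D * Submodule.span ℂ {g | CenteredWord φ C D g}

theorem CenteredWord.mem_centeredSpan {C : Subalgebra ℂ A} {g : A} (h : CenteredWord φ C D g) :
    g ∈ centeredSpan φ C D := by
  rw [← one_mul g]
  exact Submodule.mul_mem_mul (one_mem D) (Submodule.subset_span h)

theorem mul_mem_centeredSpan {C : Subalgebra ℂ A} {δ w : A} (hδ : δ ∈ D)
    (hw : w ∈ centeredSpan φ C D) : δ * w ∈ centeredSpan φ C D := by
  have h : Subalgebra.toSubmodule D * centeredSpan φ C D = centeredSpan φ C D := by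
    rw [centeredSpan, ← mul_assoc, (Subalgebra.isIdempotentElem_toSubmodule D).eq]
  rw [← h]
  exact Submodule.mul_mem_mul hδ hw

theorem mul_mem_sup_of_mem_diag {C : Subalgebra ℂ A} {δ x : A} (hδ : δ ∈ D)
    (hx : x ∈ Subalgebra.toSubmodule D ⊔ centeredSpan φ C D) :
    δ * x ∈ Subalgebra.toSubmodule D ⊔ centeredSpan φ C D := by
  obtain ⟨a, ha, b, hb, rfl⟩ := Submodule.mem_sup.1 hx
  rw [mul_add]
  exact Submodule.add_mem_sup (D.mul_mem hδ ha) (mul_mem_centeredSpan hδ hb)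

/-- The new letter merges with the first letter `v` of the word: `u * v` is its center plus a
scalar. The centered part starts a centered word again; the scalar part leaves the shorter remainder
`r`, preceded by an element of `D`. -/
theorem CenteredWord.mul_mem_sup (h1 : φ 1 = 1) {C : Subalgebra ℂ A} {u g : A} (hu : u ∈ C)
    (hg : CenteredWord φ C D g) :
    u * g ∈ Subalgebra.toSubmodule D ⊔ centeredSpan φ C D := by
  have key : ∀ v r : A, v ∈ C → CenteredWord φ C D (center φ (u * v) * r) →
      r ∈ Subalgebra.toSubmodule D ⊔ centeredSpan φ C D →
      u * (v * r) ∈ Subalgebra.toSubmodule D ⊔ centeredSpan φ C D := by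
    intro v r hv hw hr
    rw [← mul_assoc, eq_add_center (φ := φ) (u * v), add_mul, smul_mul_assoc, one_mul]
    exact add_mem (Submodule.smul_mem _ _ hr) (Submodule.mem_sup_right hw.mem_centeredSpan)
  cases hg with
  | base hv _ hδ =>
    exact key _ _ hv (.base (center_mem (mul_mem hu hv)) (apply_center h1 _) hδ)
      (Submodule.mem_sup_left hδ)
  | step hv _ hδ hδ0 hg =>
    exact key _ _ hv (.step (center_mem (mul_mem hu hv)) (apply_center h1 _) hδ hδ0 hg)
      (mul_mem_sup_of_mem_diag hδ (Submodule.mem_sup_right hg.mem_centeredSpan))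

theorem mul_mem_sup_of_mem (h1 : φ 1 = 1) {C : Subalgebra ℂ A} {u x : A} (hu : u ∈ C)
    (hx : x ∈ Subalgebra.toSubmodule D ⊔ centeredSpan φ C D) :
    u * x ∈ Subalgebra.toSubmodule D ⊔ centeredSpan φ C D := by
  rw [eq_add_center (φ := φ) u, add_mul, smul_mul_assoc, one_mul]
  refine add_mem (Submodule.smul_mem _ _ hx) ?_
  have hc := center_mem (φ := φ) hu
  have hc0 := apply_center h1 u
  generalize center φ u = u at hc hc0
  obtain ⟨a, ha, b, hb, rfl⟩ := Submodule.mem_sup.1 hx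
  rw [mul_add]
  refine add_mem (Submodule.mem_sup_right (CenteredWord.base hc hc0 ha).mem_centeredSpan) ?_
  refine Submodule.mul_induction_on hb (fun δ hδ g hg => ?_) fun x y hx hy => ?_
  · induction hg using Submodule.span_induction with
    | mem g hg =>
      -- The scalar part of `δ` brings two letters of `C` together, which is the previous lemma; the
      -- centered part lengthens the word.
      rw [eq_add_center (φ := φ) δ, add_mul, mul_add, smul_mul_assoc, one_mul, mul_smul_comm]
      exact add_mem (Submodule.smul_mem _ _ (hg.mul_mem_sup h1 hc)) (Submodule.mem_sup_right
        (CenteredWord.step hc hc0 (center_mem hδ) (apply_center h1 _) hg).mem_centeredSpan)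
    | zero => simp
    | add a b _ _ ha hb => rw [mul_add, mul_add]; exact add_mem ha hb
    | smul c a _ ha => rw [mul_smul_comm, mul_smul_comm]; exact Submodule.smul_mem _ _ ha
  · rw [mul_add]; exact add_mem hx hy

/-- The right-hand side contains `1` and is stable under left multiplication by the generators `D`
and `C`. -/
theorem sup_le_diag_sup_centeredSpan (h1 : φ 1 = 1) {C : Subalgebra ℂ A} :
    Subalgebra.toSubmodule (D ⊔ C) ≤ Subalgebra.toSubmodule D ⊔ centeredSpan φ C D := by
  intro x hx
  have h : ∀ y ∈ Subalgebra.toSubmodule D ⊔ centeredSpan φ C D,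
      x * y ∈ Subalgebra.toSubmodule D ⊔ centeredSpan φ C D := by
    rw [Subalgebra.mem_toSubmodule, ← Algebra.adjoin_eq D, ← Algebra.adjoin_eq C,
      ← Algebra.adjoin_union] at hx
    induction hx using Algebra.adjoin_induction with
    | mem x hx =>
      intro y hy
      rcases hx with hx | hx
      · exact mul_mem_sup_of_mem_diag hx hy
      · exact mul_mem_sup_of_mem h1 hx hy
    | algebraMap r => intro y hy; rw [← Algebra.smul_def]; exact Submodule.smul_mem _ _ hy
    | add a b _ _ ha hb => intro y hy; rw [add_mul]; exact add_mem (ha y hy) (hb y hy)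
    | mul a b _ _ ha hb => intro y hy; rw [mul_assoc]; exact ha _ (hb y hy)
  simpa using h 1 (Submodule.mem_sup_left (one_mem D))

/-- The elements `b ∈ B` with `φ(δ b) = 0` for all `δ ∈ D`. -/
def orthIn (φ : A →ₗ[ℂ] ℂ) (B D : Subalgebra ℂ A) : Submodule ℂ A where
  carrier := {b | b ∈ B ∧ ∀ δ ∈ D, φ (δ * b) = 0}
  zero_mem' := ⟨zero_mem B, by simp⟩
  add_mem' ha hb := ⟨add_mem ha.1 hb.1, fun δ hδ => by
    rw [mul_add, map_add, ha.2 δ hδ, hb.2 δ hδ, add_zero]⟩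
  smul_mem' c a ha := ⟨B.smul_mem ha.1 c, fun δ hδ => by
    rw [mul_smul_comm, map_smul, ha.2 δ hδ, smul_zero]⟩

theorem orthIn_left {B : Subalgebra ℂ A} (hDB : D ≤ B) {δ b : A} (hδ : δ ∈ D)
    (hb : b ∈ orthIn φ B D) : δ * b ∈ orthIn φ B D :=
  ⟨mul_mem (hDB hδ) hb.1, fun γ hγ => by rw [← mul_assoc]; exact hb.2 _ (mul_mem hγ hδ)⟩

theorem orthIn_right (htr : ∀ a b, φ (a * b) = φ (b * a)) {B : Subalgebra ℂ A} (hDB : D ≤ B)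
    {δ b : A} (hδ : δ ∈ D) (hb : b ∈ orthIn φ B D) : b * δ ∈ orthIn φ B D :=
  ⟨mul_mem hb.1 (hDB hδ), fun γ hγ => by
    rw [← mul_assoc, htr, ← mul_assoc]; exact hb.2 _ (mul_mem hδ hγ)⟩

theorem orthIn_apply {B : Subalgebra ℂ A} {b : A} (hb : b ∈ orthIn φ B D) : φ b = 0 := by
  simpa using hb.2 1 (one_mem D)

/-- A space that contains the alternating words of `D`-centered elements beginning with the
given index. -/
def wordSpace (φ : A →ₗ[ℂ] ℂ) (F : Option I → Subalgebra ℂ A) (D : Subalgebra ℂ A) :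
    Option I → Submodule ℂ A
  | none => orthIn φ (F none) D ⊔ orthIn φ (F none) D * ⨆ s, altSpan φ F (some s)
  | some s => Subalgebra.toSubmodule D * altSpan φ F (some s)

theorem mul_mem_altSpan_none {b v : A} (hb : b ∈ F none) (hb0 : φ b = 0)
    (hv : v ∈ ⨆ s, altSpan φ F (some s)) : b * v ∈ altSpan φ F none := by
  induction hv using Submodule.iSup_induction' with
  | mem s v hv => exact mul_mem_altSpan hb hb0 (by simp) hv
  | zero => simp
  | add a b _ _ ha hb => rw [mul_add]; exact add_mem ha hb

theorem wordSpace_none_le : wordSpace φ F D none ≤ altSpan φ F none := by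
  refine sup_le (fun b hb => mem_altSpan_single hb.1 (orthIn_apply hb)) ?_
  exact Submodule.mul_le.2 fun b hb v hv => mul_mem_altSpan_none hb.1 (orthIn_apply hb) hv

/-- Splitting the left coefficient `δ` into scalar and centered parts: the scalar part leaves the
word alone, while the centered part becomes a new first letter from `F none`. -/
theorem wordSpace_some_le (h1 : φ 1 = 1) (hD : D ≤ F none) (s : I) :
    wordSpace φ F D (some s) ≤ altSpan φ F none ⊔ altSpan φ F (some s) := by
  refine Submodule.mul_le.2 fun δ hδ v hv => ?_
  rw [eq_add_center (φ := φ) δ, add_mul, smul_mul_assoc, one_mul]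
  exact add_mem (Submodule.smul_mem _ _ (Submodule.mem_sup_right hv)) (Submodule.mem_sup_left
    (mul_mem_altSpan (center_mem (hD hδ)) (apply_center h1 _) (by simp) hv))

theorem mul_mem_wordSpace (hD : D ≤ F none) {i : Option I} {δ t : A} (hδ : δ ∈ D)
    (ht : t ∈ wordSpace φ F D i) : δ * t ∈ wordSpace φ F D i := by
  cases i with
  | none =>
    obtain ⟨a, ha, b, hb, rfl⟩ := Submodule.mem_sup.1 ht
    rw [mul_add]
    refine Submodule.add_mem_sup (orthIn_left hD hδ ha) ?_
    refine Submodule.mul_induction_on hb (fun b hb v hv => ?_) fun x y hx hy => ?_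
    · rw [← mul_assoc]; exact Submodule.mul_mem_mul (orthIn_left hD hδ hb) hv
    · rw [mul_add]; exact add_mem hx hy
  | some s =>
    have h : Subalgebra.toSubmodule D * wordSpace φ F D (some s) = wordSpace φ F D (some s) := by
      rw [wordSpace, ← mul_assoc, (Subalgebra.isIdempotentElem_toSubmodule D).eq]
    rw [← h]
    exact Submodule.mul_mem_mul hδ ht

theorem altSpan_le_wordSpace (s : I) : altSpan φ F (some s) ≤ wordSpace φ F D (some s) := by
  intro v hv
  rw [← one_mul v]
  exact Submodule.mul_mem_mul (one_mem D) hv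

theorem apply_wordSpace (h1 : φ 1 = 1) (hF : AlternatingVanish φ F) (hD : D ≤ F none)
    {i : Option I} {t : A} (ht : t ∈ wordSpace φ F D i) : φ t = 0 := by
  cases i with
  | none => exact hF.apply_altSpan (wordSpace_none_le ht)
  | some s =>
    obtain ⟨a, ha, b, hb, rfl⟩ := Submodule.mem_sup.1 (wordSpace_some_le h1 hD s ht)
    rw [map_add, hF.apply_altSpan ha, hF.apply_altSpan hb, add_zero]

/-- `t` may follow a centered element of `F (some s)` and an element of `D`. -/
def CanFollow (φ : A →ₗ[ℂ] ℂ) (F : Option I → Subalgebra ℂ A) (D : Subalgebra ℂ A) (s : I)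
    (t : A) : Prop :=
  ∀ u ∈ F (some s), φ u = 0 → ∀ δ ∈ D, u * (δ * t) ∈ altSpan φ F (some s)

theorem canFollow_one (h1 : φ 1 = 1) (hD : D ≤ F none) (s : I) : CanFollow φ F D s 1 := by
  intro u hu hu0 δ hδ
  rw [mul_one, eq_add_center (φ := φ) δ, mul_add, mul_smul_comm, mul_one]
  exact add_mem (Submodule.smul_mem _ _ (mem_altSpan_single hu hu0)) (mul_mem_altSpan hu hu0
    (by simp) (mem_altSpan_single (i := none) (center_mem (hD hδ)) (apply_center h1 _)))

/-- The element `δ * t` stays in the word space of `i`, hence is a sum of words starting in `none`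
or in `i`. Both indices differ from `some s`, so the letter `u` can be put in front. -/
theorem canFollow_of_mem (h1 : φ 1 = 1) (hD : D ≤ F none) {s : I} {i : Option I}
    (hi : some s ≠ i) {t : A} (ht : t ∈ wordSpace φ F D i) : CanFollow φ F D s t := by
  intro u hu hu0 δ hδ
  have ht' := mul_mem_wordSpace hD hδ ht
  cases i with
  | none => exact mul_mem_altSpan hu hu0 hi (wordSpace_none_le ht')
  | some r =>
    obtain ⟨a, ha, b, hb, hab⟩ := Submodule.mem_sup.1 (wordSpace_some_le h1 hD r ht')
    rw [← hab, mul_add]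
    exact add_mem (mul_mem_altSpan hu hu0 (by simp) ha) (mul_mem_altSpan hu hu0 hi hb)

theorem CenteredWord.mul_mem_altSpan (hD : D ≤ F none) {s : I} {g t : A}
    (hg : CenteredWord φ (F (some s)) D g) (ht : CanFollow φ F D s t) :
    g * t ∈ altSpan φ F (some s) := by
  induction hg with
  | base hu hu0 hδ => rw [mul_assoc]; exact ht _ hu hu0 _ hδ
  | step hu hu0 hδ hδ0 _ ih =>
    rw [mul_assoc, mul_assoc]
    exact RectFree.mul_mem_altSpan hu hu0 (by simp)
      (RectFree.mul_mem_altSpan (i := none) (hD hδ) hδ0 (by simp) ih)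

theorem centeredSpan_mul_mem (hD : D ≤ F none) {s : I} {w t : A}
    (hw : w ∈ centeredSpan φ (F (some s)) D) (ht : CanFollow φ F D s t) :
    w * t ∈ wordSpace φ F D (some s) := by
  refine Submodule.mul_induction_on hw (fun δ hδ g hg => ?_) fun x y hx hy => ?_
  · rw [mul_assoc]
    refine Submodule.mul_mem_mul hδ ?_
    induction hg using Submodule.span_induction with
    | mem g hg => exact hg.mul_mem_altSpan hD ht
    | zero => simp
    | add a b _ _ ha hb => rw [add_mul]; exact add_mem ha hb
    | smul c a _ ha => rw [smul_mul_assoc]; exact Submodule.smul_mem _ _ ha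
  · rw [add_mul]; exact add_mem hx hy

end Amalgamation

/-! ### Freeness with amalgamation over `𝒟` -/

section Freeness

variable {A : Type*} [Ring A] [Algebra ℂ A] {φ : A →ₗ[ℂ] ℂ} {I : Type*}
  {F : Option I → Subalgebra ℂ A} {d : ℕ} {p : Fin d → A}

theorem condExp_wordSpace (h1 : φ 1 = 1) (htr : ∀ a b, φ (a * b) = φ (b * a))
    (hp : CompleteOrthogonalIdempotents p) (hρ : ∀ k, φ (p k) ≠ 0) (hF : AlternatingVanish φ F)
    (hD : diagAlg hp ≤ F none) {i : Option I} {t : A} (ht : t ∈ wordSpace φ F (diagAlg hp) i) :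
    condExp φ p t = 0 :=
  (condExp_eq_zero_iff htr hp hρ).2 fun _ hδ => apply_wordSpace h1 hF hD (mul_mem_wordSpace hD hδ ht)

/-- In the decomposition `x = δ + w`, the part `w` is killed by `E` and `E δ = δ`, so `E x = 0`
forces `δ = 0`. -/
theorem mem_centeredSpan_of_condExp (h1 : φ 1 = 1) (htr : ∀ a b, φ (a * b) = φ (b * a))
    (hp : CompleteOrthogonalIdempotents p) (hρ : ∀ k, φ (p k) ≠ 0) (hF : AlternatingVanish φ F)
    (hD : diagAlg hp ≤ F none) {s : I} {x : A} (hx : x ∈ diagAlg hp ⊔ F (some s))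
    (h0 : condExp φ p x = 0) : x ∈ centeredSpan φ (F (some s)) (diagAlg hp) := by
  obtain ⟨δ, hδ, w, hw, rfl⟩ := Submodule.mem_sup.1 (sup_le_diag_sup_centeredSpan (φ := φ) h1 hx)
  have hw' := centeredSpan_mul_mem hD hw (canFollow_one h1 hD s)
  rw [mul_one] at hw'
  rw [map_add, condExp_wordSpace h1 htr hp hρ hF hD hw', condExp_of_mem htr hp hρ hδ, add_zero] at h0
  rwa [h0, zero_add]

/-- Adjoining `𝒟` to all the algebras of a `φ`-free family one of which contains `𝒟` gives a family
that is free with amalgamation over `𝒟`. -/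
theorem alternatingVanish_condExp (h1 : φ 1 = 1) (htr : ∀ a b, φ (a * b) = φ (b * a))
    (hp : CompleteOrthogonalIdempotents p) (hρ : ∀ k, φ (p k) ≠ 0) (hF : AlternatingVanish φ F)
    (hD : diagAlg hp ≤ F none) :
    AlternatingVanish (condExp φ p) fun i => diagAlg hp ⊔ F i := by
  refine alternatingVanish_iff.2 fun i w hw => ?_
  refine condExp_wordSpace h1 htr hp hρ hF hD (i := i) ?_
  have hN : ∀ x ∈ diagAlg hp ⊔ F none, condExp φ p x = 0 → x ∈ orthIn φ (F none) (diagAlg hp) := by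
    intro x hx h0
    rw [sup_eq_right.2 hD] at hx
    exact ⟨hx, (condExp_eq_zero_iff htr hp hρ).1 h0⟩
  induction hw with
  | @single i x hx h0 =>
    cases i with
    | none => exact Submodule.mem_sup_left (hN x hx h0)
    | some s =>
      rw [← mul_one x]
      exact centeredSpan_mul_mem hD (mem_centeredSpan_of_condExp h1 htr hp hρ hF hD hx h0)
        (canFollow_one h1 hD s)
  | @cons i j x w hx h0 hij _ ih =>
    cases i with
    | none =>
      cases j with
      | none => exact absurd rfl hij
      | some s =>
        refine Submodule.mem_sup_right ?_
        refine Submodule.mul_induction_on ih (fun δ hδ v hv => ?_) fun a b ha hb => ?_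
        -- The left coefficient `δ` of the following word is absorbed into `x` from the right; by
        -- traciality `x * δ` is still orthogonal to `𝒟`.
        · rw [← mul_assoc]
          exact Submodule.mul_mem_mul (orthIn_right htr hD hδ (hN x hx h0))
            (Submodule.mem_iSup_of_mem s hv)
        · rw [mul_add]; exact add_mem ha hb
    | some s =>
      exact centeredSpan_mul_mem hD (mem_centeredSpan_of_condExp h1 htr hp hρ hF hD hx h0)
        (canFollow_of_mem h1 hD hij ih)

end Freeness

/-! ### Chebyshev polynomials are centered for the semicircle law -/

section Chebyshev

open Polynomial

/-- Under `x = 2 cos θ` the density contributes `(2 / π) sin² θ dθ`, and `Sₙ₊₁(2 cos θ) sin θ = sin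
((n + 2) θ)`. The integrand becomes `π⁻¹ (cos ((n + 1) θ) - cos ((n + 3) θ))`, whose two terms
integrate to zero over `[0, π]`. -/
theorem integral_chebyshevS_semicircle (n : ℕ) :
    ∫ x in (-2 : ℝ)..2, (Chebyshev.S ℝ ((n + 1 : ℕ) : ℤ)).eval x * (√(4 - x ^ 2) / (2 * Real.pi)) =
      0 := by
  have hsub := intervalIntegral.integral_comp_mul_deriv (a := Real.pi) (b := 0)
    (f := fun θ => 2 * Real.cos θ) (f' := fun θ => 2 * -Real.sin θ)
    (g := fun x => (Chebyshev.S ℝ ((n + 1 : ℕ) : ℤ)).eval x * (√(4 - x ^ 2) / (2 * Real.pi)))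
    (fun θ _ => (Real.hasDerivAt_cos θ).const_mul 2) (by fun_prop) (by fun_prop)
  simp only [Real.cos_pi, Real.cos_zero, mul_neg, mul_one] at hsub
  rw [← hsub, intervalIntegral.integral_symm, neg_eq_zero]
  have hne : ∀ m : ℕ, ∫ θ in (0 : ℝ)..Real.pi, Real.cos ((m + 1 : ℕ) * θ) = 0 := by
    intro m
    rw [intervalIntegral.integral_comp_mul_left _ (by positivity), integral_cos]
    simp [Real.sin_nat_mul_pi, -Nat.cast_add]
  have hcong : ∀ θ ∈ Set.uIcc 0 Real.pi,
      -(((fun x => (Chebyshev.S ℝ ((n + 1 : ℕ) : ℤ)).eval x * (√(4 - x ^ 2) / (2 * Real.pi))) ∘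
        fun θ => 2 * Real.cos θ) θ * (2 * Real.sin θ)) =
      -Real.pi⁻¹ * (Real.cos ((n + 1 : ℕ) * θ) - Real.cos ((n + 2 + 1 : ℕ) * θ)) := by
    intro θ hθ
    rw [Set.uIcc_of_le Real.pi_pos.le] at hθ
    have hs : √(4 - (2 * Real.cos θ) ^ 2) = 2 * Real.sin θ := by
      rw [show 4 - (2 * Real.cos θ) ^ 2 = (2 * Real.sin θ) ^ 2 by
        nlinarith [Real.sin_sq_add_cos_sq θ]]
      exact Real.sqrt_sq (mul_nonneg two_pos.le (Real.sin_nonneg_of_mem_Icc hθ))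
    have hS := Chebyshev.S_two_mul_real_cos θ ((n + 1 : ℕ) : ℤ)
    have hc1 : Real.cos ((n + 1 : ℕ) * θ) = Real.cos (((n + 2 : ℕ) : ℝ) * θ - θ) := by
      congr 1; push_cast; ring
    have hc2 : Real.cos ((n + 2 + 1 : ℕ) * θ) = Real.cos (((n + 2 : ℕ) : ℝ) * θ + θ) := by
      congr 1; push_cast; ring
    have hS' : (Chebyshev.S ℝ ((n + 1 : ℕ) : ℤ)).eval (2 * Real.cos θ) * Real.sin θ =
        Real.sin (((n + 2 : ℕ) : ℝ) * θ) := by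
      rw [hS]; congr 1; push_cast; ring
    simp only [Function.comp_apply]
    rw [hs, hc1, hc2, Real.cos_sub, Real.cos_add]
    have hpi := Real.pi_ne_zero
    field_simp
    linear_combination (-2 * Real.sin θ) * hS'
  rw [intervalIntegral.integral_congr hcong, intervalIntegral.integral_const_mul,
    intervalIntegral.integral_sub (Continuous.intervalIntegrable (by fun_prop) _ _)
      (Continuous.intervalIntegrable (by fun_prop) _ _), hne, hne, sub_zero, mul_zero]

variable {A : Type*} [Ring A] [StarRing A] [Algebra ℂ A] {φ : A →ₗ[ℂ] ℂ} {y : A}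

theorem IsSemicircular.apply_aeval (hy : IsSemicircular φ y) (P : ℝ[X]) :
    φ (aeval y (P.map (algebraMap ℝ ℂ))) =
      ((∫ x in (-2 : ℝ)..2, P.eval x * (√(4 - x ^ 2) / (2 * Real.pi)) : ℝ) : ℂ) := by
  induction P using Polynomial.induction_on' with
  | add P Q hP hQ =>
    simp only [Polynomial.map_add, map_add, hP, hQ, eval_add, add_mul]
    rw [intervalIntegral.integral_add, Complex.ofReal_add]
    all_goals exact (Continuous.intervalIntegrable (by fun_prop) _ _)
  | monomial n a =>
    simp only [Polynomial.map_monomial, aeval_monomial, eval_monomial, mul_assoc]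
    rw [intervalIntegral.integral_const_mul, ← Algebra.smul_def, map_smul, hy.2 n]
    simp

theorem IsSemicircular.apply_chebyshev (hy : IsSemicircular φ y) (n : ℕ) :
    φ (aeval y (Chebyshev.S ℂ ((n + 1 : ℕ) : ℤ))) = 0 := by
  have h := hy.apply_aeval (Chebyshev.S ℝ ((n + 1 : ℕ) : ℤ))
  rwa [Chebyshev.map_S, integral_chebyshevS_semicircle, Complex.ofReal_zero] at h

end Chebyshev

/-! ### `𝒟`-valued moments of a semicircular element -/

section Moments

variable {A : Type*} [Ring A] [Algebra ℂ A] {φ : A →ₗ[ℂ] ℂ} {I : Type*}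
  {F : Option I → Subalgebra ℂ A} {D : Subalgebra ℂ A}

/-- With `wᵢ = X δᵢ ⋯ X δₙ₋₁` and `U` the Chebyshev polynomials of `X`, the element obtained from
`Uₘ δᵢ wᵢ₊₁` by subtracting its contractions. -/
def wick (φ : A →ₗ[ℂ] ℂ) (U w δ : ℕ → A) (S : ℕ → ℕ → A) (n : ℕ) : ℕ → ℕ → A
  | 0, i => δ i * w (i + 1)
  | m + 1, i => U (m + 1) * (δ i * w (i + 1)) -
      ∑ j ∈ Finset.Ico (i + 1) n, φ (δ i * S (i + 1) j) • (U m * (δ j * w (j + 1)))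

/-- The moment-type recursion of the pairings of `δᵢ, …, δⱼ₋₁`. -/
structure IsPairingSum (φ : A →ₗ[ℂ] ℂ) (D : Subalgebra ℂ A) (δ : ℕ → A) (n : ℕ)
    (S : ℕ → ℕ → A) : Prop where
  mem : ∀ i j, S i j ∈ D
  self : ∀ i, S i i = 1
  step : ∀ i j, i < j → j ≤ n →
    S i j = ∑ k ∈ Finset.Ico (i + 1) j, φ (δ i * S (i + 1) k) • (δ k * S (k + 1) j)

variable {U w δ : ℕ → A} {S : ℕ → ℕ → A} {n : ℕ} {X : A}

theorem wick_add_two (hU1 : U 1 = X) (hU0 : U 0 = 1) (hU : ∀ m, U (m + 2) = U (m + 1) * X - U m)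
    (m i : ℕ) :
    wick φ U w δ S n (m + 2) i =
      U (m + 1) * wick φ U w δ S n 1 i - U m * wick φ U w δ S n 0 i := by
  simp only [wick, hU, hU1, hU0, zero_add, one_mul, mul_sub, sub_mul, Finset.mul_sum,
    mul_smul_comm, mul_assoc]
  abel

/-- Wick expansion of the word. The definition of `wick` at `m = 1` writes `w i` as a Wick element
plus contractions; expanding each shorter tail `w (j + 1)` inductively and exchanging sums collects
the coefficients into `S i l` by the pairing recursion. -/
theorem word_eq (hS : IsPairingSum φ D δ n S) (hU1 : U 1 = X) (hU0 : U 0 = 1) (hwn : w n = 1)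
    (hw : ∀ i < n, w i = X * (δ i * w (i + 1))) (i : ℕ) (hi : i ≤ n) :
    w i = S i n + ∑ j ∈ Finset.Ico i n, S i j * wick φ U w δ S n 1 j := by
  induction h : n - i using Nat.strong_induction_on generalizing i with
  | _ r ih =>
  rcases hi.eq_or_lt with rfl | hin
  · simp [hwn, hS.self]
  have h1 : w i = wick φ U w δ S n 1 i +
      ∑ j ∈ Finset.Ico (i + 1) n, φ (δ i * S (i + 1) j) • (δ j * w (j + 1)) := by
    simp [wick, hU1, hU0, hw i hin]
  have h2 : ∀ j ∈ Finset.Ico (i + 1) n, φ (δ i * S (i + 1) j) • (δ j * w (j + 1)) =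
      φ (δ i * S (i + 1) j) • (δ j * S (j + 1) n) + ∑ l ∈ Finset.Ico (j + 1) n,
        φ (δ i * S (i + 1) j) • (δ j * S (j + 1) l) * wick φ U w δ S n 1 l := by
    intro j hj
    rw [Finset.mem_Ico] at hj
    rw [ih (n - (j + 1)) (by omega) (j + 1) (by omega) rfl, mul_add, smul_add, Finset.mul_sum,
      Finset.smul_sum]
    simp only [smul_mul_assoc, mul_assoc]
  have h3 : ∀ l ∈ Finset.Ico (i + 1) n, S i l * wick φ U w δ S n 1 l =
      ∑ j ∈ Finset.Ico (i + 1) l,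
        φ (δ i * S (i + 1) j) • (δ j * S (j + 1) l) * wick φ U w δ S n 1 l := by
    intro l hl
    rw [Finset.mem_Ico] at hl
    rw [hS.step i l (by omega) (by omega), Finset.sum_mul]
  have h4 : ∑ j ∈ Finset.Ico (i + 1) n, ∑ l ∈ Finset.Ico (j + 1) n,
        φ (δ i * S (i + 1) j) • (δ j * S (j + 1) l) * wick φ U w δ S n 1 l =
      ∑ l ∈ Finset.Ico (i + 1) n, ∑ j ∈ Finset.Ico (i + 1) l,
        φ (δ i * S (i + 1) j) • (δ j * S (j + 1) l) * wick φ U w δ S n 1 l :=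
    Finset.sum_comm' fun j l => by simp only [Finset.mem_Ico]; omega
  rw [h1, Finset.sum_congr rfl h2, Finset.sum_add_distrib, ← hS.step i n hin le_rfl,
    Finset.sum_eq_sum_Ico_succ_bot hin, hS.self, one_mul, Finset.sum_congr rfl h3, h4]
  abel

/-- Expand `w (i + 1)` by `word_eq` and split each coefficient `δ i * S (i + 1) j` into center and
scalar. On the scalar part, the three-term recursion turns `U (m + 1)` times a first-order Wick
element into one of order `m + 2` plus `U m * (δ j * w (j + 1))`, which cancels the subtracted
contraction. The factor `1` is the empty continuation required by `CanFollow`. -/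
theorem wick_eq (hS : IsPairingSum φ D δ n S) (hU1 : U 1 = X) (hU0 : U 0 = 1)
    (hU : ∀ m, U (m + 2) = U (m + 1) * X - U m) (hwn : w n = 1)
    (hw : ∀ i < n, w i = X * (δ i * w (i + 1))) (m i : ℕ) (hi : i < n) :
    wick φ U w δ S n (m + 1) i = U (m + 1) * (δ i * S (i + 1) n * 1) +
      ∑ j ∈ Finset.Ico (i + 1) n,
        (U (m + 1) * (center φ (δ i * S (i + 1) j) * wick φ U w δ S n 1 j) +
          φ (δ i * S (i + 1) j) • wick φ U w δ S n (m + 2) j) := by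
  have h : ∀ j ∈ Finset.Ico (i + 1) n,
      U (m + 1) * (center φ (δ i * S (i + 1) j) * wick φ U w δ S n 1 j) +
          φ (δ i * S (i + 1) j) • wick φ U w δ S n (m + 2) j =
      U (m + 1) * (δ i * (S (i + 1) j * wick φ U w δ S n 1 j)) -
        φ (δ i * S (i + 1) j) • (U m * (δ j * w (j + 1))) := by
    intro j _
    rw [wick_add_two hU1 hU0 hU, center, sub_mul, mul_sub, smul_mul_assoc, one_mul, mul_smul_comm,
      smul_sub, mul_assoc]
    simp only [wick]
    abel
  rw [Finset.sum_congr rfl h, Finset.sum_sub_distrib, ← Finset.mul_sum, ← Finset.mul_sum,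
    ← add_sub_assoc, mul_one, ← mul_add, ← mul_add, ← word_eq hS hU1 hU0 hwn hw (i + 1) hi]
  rfl

theorem wick_mem_altSpan (h1 : φ 1 = 1) (hD : D ≤ F none) {s : I} (hS : IsPairingSum φ D δ n S)
    (hδ : ∀ i, δ i ∈ D) (hUF : ∀ m, U m ∈ F (some s)) (hUφ : ∀ m, φ (U (m + 1)) = 0)
    (hU1 : U 1 = X) (hU0 : U 0 = 1)
    (hU : ∀ m, U (m + 2) = U (m + 1) * X - U m) (hwn : w n = 1)
    (hw : ∀ i < n, w i = X * (δ i * w (i + 1))) (m i : ℕ) (hi : i < n) :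
    wick φ U w δ S n (m + 1) i ∈ altSpan φ F (some s) := by
  -- The order `m` must vary: the recursion moves to later positions `j > i` but may raise the
  -- order.
  induction h : n - i using Nat.strong_induction_on generalizing i m with
  | _ r ih =>
  rw [wick_eq hS hU1 hU0 hU hwn hw m i hi]
  have hd : ∀ j, δ i * S (i + 1) j ∈ D := fun j => mul_mem (hδ i) (hS.mem _ _)
  refine add_mem (canFollow_one h1 hD s _ (hUF _) (hUφ m) _ (hd n)) (sum_mem fun j hj => ?_)
  rw [Finset.mem_Ico] at hj
  refine add_mem (mul_mem_altSpan (hUF _) (hUφ m) (by simp) (mul_mem_altSpan (i := none)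
    (hD (center_mem (hd j))) (apply_center h1 _) (by simp)
    (ih (n - j) (by omega) 0 j hj.2 rfl))) (Submodule.smul_mem _ _ ?_)
  exact ih (n - j) (by omega) (m + 1) j hj.2 rfl

theorem condExp_word {d : ℕ} {p : Fin d → A} (h1 : φ 1 = 1) (htr : ∀ a b, φ (a * b) = φ (b * a))
    (hp : CompleteOrthogonalIdempotents p) (hρ : ∀ k, φ (p k) ≠ 0) (hF : AlternatingVanish φ F)
    (hD : diagAlg hp ≤ F none) {s : I} (hS : IsPairingSum φ (diagAlg hp) δ n S)
    (hδ : ∀ i, δ i ∈ diag p) (hXF : X ∈ F (some s))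
    (hX : ∀ m : ℕ, φ (Polynomial.aeval X (Polynomial.Chebyshev.S ℂ ((m + 1 : ℕ) : ℤ))) = 0)
    (hwn : w n = 1) (hw : ∀ i < n, w i = X * (δ i * w (i + 1))) :
    condExp φ p (w 0) = S 0 n := by
  let U : ℕ → A := fun m => Polynomial.aeval X (Polynomial.Chebyshev.S ℂ (m : ℤ))
  have hU1 : U 1 = X := by simp [U]
  have hU0 : U 0 = 1 := by simp [U]
  have hU : ∀ m, U (m + 2) = U (m + 1) * X - U m := by
    intro m
    have := Polynomial.Chebyshev.S_add_two ℂ (m : ℤ)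
    simp only [U, Nat.cast_add, Nat.cast_ofNat, Nat.cast_one, this, map_sub]
    rw [mul_comm, map_mul, Polynomial.aeval_X]
  have hUF : ∀ m, U m ∈ F (some s) := fun m =>
    Algebra.adjoin_le (by simpa using hXF) (Polynomial.aeval_mem_adjoin_singleton ℂ X)
  rw [word_eq (φ := φ) hS hU1 hU0 hwn hw 0 (Nat.zero_le n), map_add, map_sum,
    condExp_of_mem htr hp hρ (hS.mem 0 n), Finset.sum_eq_zero, add_zero]
  intro j hj
  refine condExp_wordSpace h1 htr hp hρ hF hD (i := some s) (mul_mem_wordSpace hD (hS.mem _ _) ?_)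
  exact altSpan_le_wordSpace s (wick_mem_altSpan h1 hD hS hδ hUF hX hU1 hU0 hU hwn hw 0 j
    (Finset.mem_Ico.1 hj).2)

end Moments

/-! ### Noncrossing partitions and the block of the first point -/

section Partitions

variable {n : ℕ} {π π' : Finpartition (Finset.univ : Finset (Fin n))}

theorem mem_part_refl (π : Finpartition (Finset.univ : Finset (Fin n))) (x : Fin n) :
    x ∈ π.part x :=
  π.mem_part (Finset.mem_univ x)

theorem mem_part_iff {x y : Fin n} : y ∈ π.part x ↔ π.part y = π.part x :=
  π.mem_part_iff_part_eq_part (Finset.mem_univ y) (Finset.mem_univ x)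

theorem mem_part_symm {x y : Fin n} (h : y ∈ π.part x) : x ∈ π.part y :=
  mem_part_iff.2 (mem_part_iff.1 h).symm

theorem mem_part_trans {x y z : Fin n} (h : y ∈ π.part x) (h' : z ∈ π.part y) : z ∈ π.part x :=
  mem_part_iff.2 ((mem_part_iff.1 h').trans (mem_part_iff.1 h))

theorem finpartition_ext_of_mem_part (h : ∀ x y, y ∈ π.part x → y ∈ π'.part x)
    (h' : ∀ x y, y ∈ π'.part x → y ∈ π.part x) : π = π' := by
  have hp : ∀ x, π.part x = π'.part x := fun x => Finset.ext fun y => ⟨h x y, h' x y⟩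
  refine Finpartition.ext (Finset.ext fun t => ⟨fun ht => ?_, fun ht => ?_⟩)
  · obtain ⟨x, hx⟩ := π.nonempty_of_mem_parts ht
    rw [← π.part_eq_of_mem ht hx, hp]
    exact π'.part_mem.2 (Finset.mem_univ x)
  · obtain ⟨x, hx⟩ := π'.nonempty_of_mem_parts ht
    rw [← π'.part_eq_of_mem ht hx, ← hp]
    exact π.part_mem.2 (Finset.mem_univ x)

open Classical in
theorem exists_finpartition {r : Fin n → Fin n → Prop} (hr : Equivalence r) :
    ∃ π : Finpartition (Finset.univ : Finset (Fin n)), ∀ x y, y ∈ π.part x ↔ r x y :=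
  ⟨Finpartition.ofSetoid ⟨r, hr⟩, fun _ _ => Finpartition.mem_part_ofSetoid_iff_rel⟩

/-- The positions `x` with `i ≤ x < j`. -/
def interval (n i j : ℕ) : Finset (Fin n) :=
  Finset.univ.filter fun x => i ≤ x.1 ∧ x.1 < j

theorem mem_interval {i j : ℕ} {x : Fin n} : x ∈ interval n i j ↔ i ≤ x.1 ∧ x.1 < j := by
  simp [interval]

/-- All blocks of `π` with at least two elements lie in `[i, j)`. -/
def SupportedOn (π : Finpartition (Finset.univ : Finset (Fin n))) (i j : ℕ) : Prop :=
  ∀ x y : Fin n, y ∈ π.part x → x = y ∨ (x ∈ interval n i j ∧ y ∈ interval n i j)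

open Classical in
/-- The noncrossing partitions supported on `[i, j)`. -/
def ncOn (n i j : ℕ) : Finset (Finpartition (Finset.univ : Finset (Fin n))) :=
  Finset.univ.filter fun π => IsNoncrossing π ∧ SupportedOn π i j

theorem mem_ncOn {i j : ℕ} : π ∈ ncOn n i j ↔ IsNoncrossing π ∧ SupportedOn π i j := by
  simp [ncOn]

theorem ncOn_self (n i : ℕ) : (ncOn n i i).card = 1 := by
  obtain ⟨π, hπ⟩ := exists_finpartition (n := n) eq_equivalence
  rw [Finset.card_eq_one]
  refine ⟨π, Finset.ext fun σ => ?_⟩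
  rw [mem_ncOn, Finset.mem_singleton]
  constructor
  · rintro ⟨-, h⟩
    refine finpartition_ext_of_mem_part (fun x y hy => (hπ x y).2 ?_) fun x y hy => ?_
    · rcases h x y hy with h | ⟨h, -⟩
      · exact h
      · rw [mem_interval] at h; omega
    · rw [← (hπ x y).1 hy]; exact mem_part_refl σ x
  · rintro rfl
    refine ⟨fun a b c e hab hbc hce hca heb => ?_, fun x y h => Or.inl ((hπ x y).1 h)⟩
    have := (hπ a c).1 hca
    omega

theorem exists_restrict (π : Finpartition (Finset.univ : Finset (Fin n))) (i j : ℕ) :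
    ∃ σ : Finpartition (Finset.univ : Finset (Fin n)), ∀ x y, y ∈ σ.part x ↔
      x = y ∨ (x ∈ interval n i j ∧ y ∈ interval n i j ∧ y ∈ π.part x) :=
  exists_finpartition ⟨fun x => Or.inl rfl, fun {x y} h => by
    rcases h with rfl | ⟨h1, h2, h3⟩
    · exact Or.inl rfl
    · exact Or.inr ⟨h2, h1, mem_part_symm h3⟩, fun {x y z} h h' => by
    rcases h with rfl | ⟨h1, h2, h3⟩
    · exact h'
    · rcases h' with rfl | ⟨h1', h2', h3'⟩
      · exact Or.inr ⟨h1, h2, h3⟩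
      · exact Or.inr ⟨h1, h2', mem_part_trans h3 h3'⟩⟩

/-- The partition that agrees with `π` on `[i, j)` and has singleton blocks elsewhere. -/
def restrict (π : Finpartition (Finset.univ : Finset (Fin n))) (i j : ℕ) :
    Finpartition (Finset.univ : Finset (Fin n)) :=
  (exists_restrict π i j).choose

theorem mem_part_restrict {i j : ℕ} {x y : Fin n} : y ∈ (restrict π i j).part x ↔
    x = y ∨ (x ∈ interval n i j ∧ y ∈ interval n i j ∧ y ∈ π.part x) :=
  (exists_restrict π i j).choose_spec x y

theorem restrict_mem_ncOn (hπ : IsNoncrossing π) (i j : ℕ) : restrict π i j ∈ ncOn n i j := by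
  refine mem_ncOn.2 ⟨fun a b c e hab hbc hce hca heb => ?_, fun x y h => ?_⟩
  · rcases mem_part_restrict.1 hca with h | ⟨h1, -, h3⟩
    · omega
    rcases mem_part_restrict.1 heb with h | ⟨h1', -, h3'⟩
    · omega
    exact mem_part_restrict.2 (Or.inr ⟨h1, h1', hπ a b c e hab hbc hce h3 h3'⟩)
  · rcases mem_part_restrict.1 h with h | ⟨h1, h2, -⟩
    · exact Or.inl h
    · exact Or.inr ⟨h1, h2⟩

/-- The block of `i` is `{i, k}`. -/
def HasPair (π : Finpartition (Finset.univ : Finset (Fin n))) (i k : Fin n) : Prop :=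
  ∀ x, x ∈ π.part i ↔ x = i ∨ x = k

variable {i k : Fin n} {j : ℕ}

/-- A block meeting the inside of the pair `{i, k}` cannot leave it without crossing the pair; it
cannot reach to the left of `i` because of the support condition. -/
theorem HasPair.mem_left (hp : HasPair π i k) (hπ : π ∈ ncOn n i j) (hik : i < k) {x y : Fin n}
    (hx : x ∈ interval n (i + 1) k) (hy : y ∈ π.part x) : y ∈ interval n (i + 1) k := by
  obtain ⟨hnc, hsup⟩ := mem_ncOn.1 hπ
  rw [mem_interval] at hx ⊢
  by_contra hcon
  have hxi : x ∉ π.part i := fun h => by rcases (hp x).1 h with rfl | rfl <;> omega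
  have hyi : y ∉ π.part i := fun h => hxi (mem_part_trans h (mem_part_symm hy))
  have hyne : y ≠ i ∧ y ≠ k := ⟨fun h => hyi ((hp y).2 (Or.inl h)), fun h => hyi ((hp y).2 (Or.inr h))⟩
  rcases hsup x y hy with rfl | ⟨-, h2⟩
  · omega
  · rw [mem_interval] at h2
    exact hxi (hnc i x k y (by omega) (by omega) (by omega) ((hp k).2 (Or.inr rfl)) hy)

theorem HasPair.mem_right (hp : HasPair π i k) (hπ : π ∈ ncOn n i j) (hik : i < k) {x y : Fin n}
    (hx : x ∈ interval n (k + 1) j) (hy : y ∈ π.part x) : y ∈ interval n (k + 1) j := by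
  obtain ⟨hnc, hsup⟩ := mem_ncOn.1 hπ
  have hxi : x ∉ π.part i := fun h => by
    rw [mem_interval] at hx
    rcases (hp x).1 h with rfl | rfl <;> omega
  have hyi : y ∉ π.part i := fun h => hxi (mem_part_trans h (mem_part_symm hy))
  have hyne : y ≠ i ∧ y ≠ k := ⟨fun h => hyi ((hp y).2 (Or.inl h)), fun h => hyi ((hp y).2 (Or.inr h))⟩
  have hyl : y ∉ interval n (i + 1) k := fun h => by
    have := hp.mem_left hπ hik h (mem_part_symm hy)
    rw [mem_interval] at this hx
    omega
  rcases hsup x y hy with rfl | ⟨-, h2⟩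
  · exact hx
  · rw [mem_interval] at *
    omega

theorem HasPair.mem_cases (hp : HasPair π i k) (hπ : π ∈ ncOn n i j) (hik : i < k)
    {x y : Fin n} (hy : y ∈ π.part x) : x = y ∨ (x = i ∧ y = k) ∨ (x = k ∧ y = i) ∨
      (x ∈ interval n (i + 1) k ∧ y ∈ interval n (i + 1) k) ∨
      (x ∈ interval n (k + 1) j ∧ y ∈ interval n (k + 1) j) := by
  by_cases hl : x ∈ interval n (i + 1) k
  · exact Or.inr (Or.inr (Or.inr (Or.inl ⟨hl, hp.mem_left hπ hik hl hy⟩)))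
  by_cases hr : x ∈ interval n (k + 1) j
  · exact Or.inr (Or.inr (Or.inr (Or.inr ⟨hr, hp.mem_right hπ hik hr hy⟩)))
  rcases (mem_ncOn.1 hπ).2 x y hy with h | ⟨h, -⟩
  · exact Or.inl h
  have hx : x = i ∨ x = k := by
    rw [mem_interval] at *
    by_contra hcon
    rw [not_or] at hcon
    omega
  have hxi : x ∈ π.part i := (hp x).2 hx
  have hyi := (hp y).1 (mem_part_trans hxi hy)
  grind

/-- Every nontrivial relation of `π` is the pair itself or lies inside one of the two intervals, so
the two restrictions determine `π`. -/
theorem restrict_pair_injective {π' : Finpartition (Finset.univ : Finset (Fin n))}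
    (hp : HasPair π i k) (hπ : π ∈ ncOn n i j) (hp' : HasPair π' i k)
    (hik : i < k) (hl : restrict π (i + 1) k = restrict π' (i + 1) k)
    (hr : restrict π (k + 1) j = restrict π' (k + 1) j) {x y : Fin n} (hy : y ∈ π.part x) :
    y ∈ π'.part x := by
  have hk : k ∈ π'.part i := (hp' k).2 (Or.inr rfl)
  rcases hp.mem_cases hπ hik hy with rfl | ⟨rfl, rfl⟩ | ⟨rfl, rfl⟩ | ⟨h1, h2⟩ | ⟨h1, h2⟩
  · exact mem_part_refl π' x
  · exact hk
  · exact mem_part_symm hk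
  · have h := mem_part_restrict.2 (Or.inr ⟨h1, h2, hy⟩)
    rw [hl] at h
    rcases mem_part_restrict.1 h with rfl | h
    · exact mem_part_refl π' x
    · exact h.2.2
  · have h := mem_part_restrict.2 (Or.inr ⟨h1, h2, hy⟩)
    rw [hr] at h
    rcases mem_part_restrict.1 h with rfl | h
    · exact mem_part_refl π' x
    · exact h.2.2

/-- The inverse construction: the relation is the union of `σ`, `τ` and the pair. The supports are
disjoint intervals separated by `k`, so no crossing can arise between the three pieces. -/
theorem exists_join (hik : i < k) (hkj : k < j) {σ τ : Finpartition (Finset.univ : Finset (Fin n))}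
    (hσ : σ ∈ ncOn n (i + 1) k) (hτ : τ ∈ ncOn n (k + 1) j) :
    ∃ π ∈ ncOn n i j, HasPair π i k ∧ restrict π (i + 1) k = σ ∧ restrict π (k + 1) j = τ := by
  obtain ⟨hσn, hσs⟩ := mem_ncOn.1 hσ
  obtain ⟨hτn, hτs⟩ := mem_ncOn.1 hτ
  simp only [SupportedOn, mem_interval] at hσs hτs
  have hσr := mem_part_refl σ
  have hτr := mem_part_refl τ
  have hσy : ∀ x y, y ∈ σ.part x → x ∈ σ.part y := fun _ _ => mem_part_symm
  have hτy : ∀ x y, y ∈ τ.part x → x ∈ τ.part y := fun _ _ => mem_part_symm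
  have hσt : ∀ x y z, y ∈ σ.part x → z ∈ σ.part y → z ∈ σ.part x := fun _ _ _ => mem_part_trans
  have hτt : ∀ x y z, y ∈ τ.part x → z ∈ τ.part y → z ∈ τ.part x := fun _ _ _ => mem_part_trans
  obtain ⟨π, hπ⟩ := exists_finpartition (n := n) (r := fun x y => y ∈ σ.part x ∨ y ∈ τ.part x ∨
    (x = i ∧ y = k) ∨ (x = k ∧ y = i)) ⟨fun x => Or.inl (hσr x), fun {x y} h => by grind,
      fun {x y z} h h' => by
        rcases h with h | h | ⟨e1, e2⟩ | ⟨e1, e2⟩ <;>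
        rcases h' with h' | h' | ⟨e3, e4⟩ | ⟨e3, e4⟩ <;> grind⟩
  refine ⟨π, mem_ncOn.2 ⟨fun a b c e hab hbc hce hca heb => ?_, fun x y h => ?_⟩, fun x => ?_, ?_, ?_⟩
  · rw [hπ] at *
    have h1 := hσn a b c e hab hbc hce
    have h2 := hτn a b c e hab hbc hce
    rcases hca with h | h | ⟨rfl, rfl⟩ | ⟨rfl, rfl⟩ <;>
    rcases heb with h' | h' | ⟨rfl, rfl⟩ | ⟨rfl, rfl⟩ <;> grind
  · rw [hπ] at h
    simp only [mem_interval]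
    grind
  · rw [hπ]
    grind
  · refine finpartition_ext_of_mem_part (fun x y h => ?_) fun x y h => ?_
    · rw [mem_part_restrict, hπ] at h
      simp only [mem_interval] at h
      grind
    · rw [mem_part_restrict, hπ]
      simp only [mem_interval]
      grind
  · refine finpartition_ext_of_mem_part (fun x y h => ?_) fun x y h => ?_
    · rw [mem_part_restrict, hπ] at h
      simp only [mem_interval] at h
      grind
    · rw [mem_part_restrict, hπ]
      simp only [mem_interval]
      grind

open Classical in
/-- Noncrossing partitions of `[i, j)` in which `{i, k}` is a block are pairs of noncrossing
partitions of `(i, k)` and `(k, j)`. -/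
theorem sum_hasPair {M : Type*} [AddCommMonoid M] (hik : i < k) (hkj : k < j)
    (g : Finpartition (Finset.univ : Finset (Fin n)) →
      Finpartition (Finset.univ : Finset (Fin n)) → M) :
    ∑ π ∈ ncOn n i j with HasPair π i k, g (restrict π (i + 1) k) (restrict π (k + 1) j) =
      ∑ σ ∈ ncOn n (i + 1) k, ∑ τ ∈ ncOn n (k + 1) j, g σ τ := by
  rw [← Finset.sum_product']
  refine Finset.sum_bij (fun π _ => (restrict π (i + 1) k, restrict π (k + 1) j)) ?_ ?_ ?_ ?_
  · intro π hπ
    have h := (mem_ncOn.1 (Finset.mem_filter.1 hπ).1).1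
    exact Finset.mem_product.2 ⟨restrict_mem_ncOn h _ _, restrict_mem_ncOn h _ _⟩
  · intro π hπ π' hπ' h
    rw [Finset.mem_filter] at hπ hπ'
    rw [Prod.mk.injEq] at h
    exact finpartition_ext_of_mem_part
      (fun _ _ => restrict_pair_injective hπ.2 hπ.1 hπ'.2 hik h.1 h.2)
      (fun _ _ => restrict_pair_injective hπ'.2 hπ'.1 hπ.2 hik h.1.symm h.2.symm)
  · rintro ⟨σ, τ⟩ h
    rw [Finset.mem_product] at h
    obtain ⟨π, h1, h2, h3, h4⟩ := exists_join hik hkj h.1 h.2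
    exact ⟨π, Finset.mem_filter.2 ⟨h1, h2⟩, by rw [h3, h4]⟩
  · intro π _
    rfl

end Partitions

/-! ### Nested evaluations and the pairing recursion -/

section Nest

variable {A : Type*} [Ring A] {n : ℕ} {f : (m : ℕ) → (Fin m → A) → A} {π π' : Finpartition (Finset.univ : Finset (Fin n))}

theorem nest_empty (a : Fin n → A) : nest f π a ∅ = 1 := by
  rw [nest, dif_neg (by simp)]

theorem nest_of_nonempty (a : Fin n → A) {s : Finset (Fin n)} (hs : s.Nonempty)
    {V : Finset (Fin n)} (hV : s ∩ π.part (s.min' hs) = V) :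
    nest f π a s = f V.card (fun j => a (V.orderEmbOfFin rfl j) *
      nest f π a (gap s V (V.orderEmbOfFin rfl j))) * nest f π a (tail s V) := by
  subst hV
  rw [nest, dif_pos hs]

theorem gap_ssubset {s V : Finset (Fin n)} (hs : s.Nonempty) (hV : V ⊆ s) {v : Fin n}
    (hv : v ∈ V) : gap s V v ⊂ s := by
  refine Finset.filter_ssubset.2 ⟨_, Finset.min'_mem s hs, ?_⟩
  rintro ⟨h, -⟩
  exact absurd h (not_lt.2 (Finset.min'_le s _ (hV hv)))

theorem tail_ssubset {s V : Finset (Fin n)} (hs : s.Nonempty) (hV : s.min' hs ∈ V) :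
    tail s V ⊂ s :=
  Finset.filter_ssubset.2 ⟨_, Finset.min'_mem s hs, fun h => lt_irrefl _ (h _ hV)⟩

theorem min'_mem_inter_part {s : Finset (Fin n)} (hs : s.Nonempty) :
    s.min' hs ∈ s ∩ π.part (s.min' hs) :=
  Finset.mem_inter.2 ⟨Finset.min'_mem s hs, mem_part_refl π _⟩

/-- The recursion only sees the traces of the blocks on `s`. This allows `π` to be replaced by its
restriction to an interval. -/
theorem nest_congr (a : Fin n → A) (s : Finset (Fin n))
    (h : ∀ x ∈ s, s ∩ π.part x = s ∩ π'.part x) : nest f π a s = nest f π' a s := by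
  induction s using Finset.strongInduction with
  | _ s ih =>
  rcases s.eq_empty_or_nonempty with rfl | hs
  · rw [nest_empty, nest_empty]
  have hsub : ∀ t, t ⊂ s → nest f π a t = nest f π' a t := by
    intro t ht
    refine ih t ht fun x hx => ?_
    rw [← Finset.inter_eq_left.2 ht.subset, Finset.inter_assoc, h x (ht.subset hx),
      ← Finset.inter_assoc]
  have hmin := min'_mem_inter_part (π := π) hs
  rw [nest_of_nonempty (π := π) a hs rfl, nest_of_nonempty (π := π') a hs rfl,
    ← h _ (Finset.min'_mem s hs), hsub _ (tail_ssubset hs hmin)]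
  congr 2
  funext j
  rw [hsub _ (gap_ssubset hs Finset.inter_subset_left (Finset.orderEmbOfFin_mem _ rfl j))]

variable [Algebra ℂ A] {φ : A →ₗ[ℂ] ℂ} {D : Subalgebra ℂ A}

/-- The values of `f` on `X D` are those of the cumulants of a semicircular element. -/
structure IsSemicircularCumulant (φ : A →ₗ[ℂ] ℂ) (D : Subalgebra ℂ A) (X : A)
    (f : (m : ℕ) → (Fin m → A) → A) : Prop where
  two : ∀ b : Fin 2 → A, (∀ j, b j ∈ D) → f 2 (fun j => X * b j) = φ (b 0) • b 1
  other : ∀ m, 1 ≤ m → m ≠ 2 → ∀ b : Fin m → A, (∀ j, b j ∈ D) → f m (fun j => X * b j) = 0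

theorem nest_mem {X : A} {δ : Fin n → A} (hδ : ∀ j, δ j ∈ D)
    (hf : ∀ m, 1 ≤ m → ∀ b : Fin m → A, (∀ j, b j ∈ D) → f m (fun j => X * b j) ∈ D)
    (π : Finpartition (Finset.univ : Finset (Fin n))) (s : Finset (Fin n)) :
    nest f π (fun j => X * δ j) s ∈ D := by
  induction s using Finset.strongInduction with
  | _ s ih =>
  rcases s.eq_empty_or_nonempty with rfl | hs
  · rw [nest_empty]; exact one_mem D
  have hmin := min'_mem_inter_part (π := π) hs
  rw [nest_of_nonempty (π := π) _ hs rfl]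
  refine mul_mem ?_ (ih _ (tail_ssubset hs hmin))
  simp only [mul_assoc]
  exact hf _ (Finset.card_pos.2 ⟨_, hmin⟩) _ fun j => mul_mem (hδ _)
    (ih _ (gap_ssubset hs Finset.inter_subset_left (Finset.orderEmbOfFin_mem _ rfl j)))

theorem IsSemicircularCumulant.mem {X : A} (hf : IsSemicircularCumulant φ D X f) (m : ℕ)
    (hm : 1 ≤ m) (b : Fin m → A) (hb : ∀ j, b j ∈ D) : f m (fun j => X * b j) ∈ D := by
  by_cases h : m = 2
  · subst h; rw [hf.two b hb]; exact D.smul_mem (hb 1) _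
  · rw [hf.other m hm h b hb]; exact zero_mem D

theorem nest_eq_zero {X : A} {δ : Fin n → A} (hδ : ∀ j, δ j ∈ D)
    (hf : ∀ m, 1 ≤ m → ∀ b : Fin m → A, (∀ j, b j ∈ D) → f m (fun j => X * b j) ∈ D)
    {s : Finset (Fin n)} (hs : s.Nonempty)
    (h0 : ∀ b : Fin (s ∩ π.part (s.min' hs)).card → A, (∀ j, b j ∈ D) →
      f (s ∩ π.part (s.min' hs)).card (fun j => X * b j) = 0) :
    nest f π (fun j => X * δ j) s = 0 := by
  rw [nest_of_nonempty (π := π) _ hs rfl]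
  simp only [mul_assoc]
  rw [h0 _ fun j => mul_mem (hδ _) (nest_mem hδ hf π _), zero_mul]

theorem IsSemicircularCumulant.nest_pair {X : A} (hf : IsSemicircularCumulant φ D X f)
    {δ : Fin n → A} (hδ : ∀ j, δ j ∈ D) {s : Finset (Fin n)} (hs : s.Nonempty) {i k : Fin n}
    (hik : i < k) (hV : s ∩ π.part (s.min' hs) = {i, k}) :
    nest f π (fun j => X * δ j) s =
      φ (δ i * nest f π (fun j => X * δ j) (gap s {i, k} i)) •
        (δ k * nest f π (fun j => X * δ j) (gap s {i, k} k) *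
          nest f π (fun j => X * δ j) (tail s {i, k})) := by
  rw [nest_of_nonempty (π := π) _ hs hV]
  simp only [mul_assoc]
  -- The arity `V.card` equals `2` only propositionally, so the argument tuple is transported along
  -- a general equality `V.card = m`.
  have hcast : ∀ (V : Finset (Fin n)) (m : ℕ) (h : V.card = m) (g : Fin n → A),
      f V.card (fun j => X * g (V.orderEmbOfFin rfl j)) =
        f m (fun j => X * g (V.orderEmbOfFin h j)) := by
    rintro V _ rfl g
    rfl
  have hcard : ({i, k} : Finset (Fin n)).card = 2 := Finset.card_pair hik.ne
  have hemb : ![i, k] = ({i, k} : Finset (Fin n)).orderEmbOfFin hcard := by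
    refine Finset.orderEmbOfFin_unique hcard (fun x => ?_) ?_
    · fin_cases x <;> simp
    · intro x y hxy
      fin_cases x <;> fin_cases y <;> simp_all
  rw [hcast _ 2 hcard fun v => δ v * nest f π (fun j => X * δ j) (gap s {i, k} v),
    hf.two _ fun j => mul_mem (hδ _) (nest_mem hδ hf.mem π _), ← hemb]
  simp [mul_assoc]

theorem interval_nonempty {i : Fin n} {j : ℕ} (hij : (i : ℕ) < j) : (interval n i j).Nonempty :=
  ⟨i, mem_interval.2 ⟨le_rfl, hij⟩⟩

theorem min'_interval {i : Fin n} {j : ℕ} (hij : (i : ℕ) < j) :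
    (interval n i j).min' (interval_nonempty hij) = i := by
  refine le_antisymm (Finset.min'_le _ _ (mem_interval.2 ⟨le_rfl, hij⟩)) ?_
  exact Finset.le_min' _ _ _ fun x hx => (mem_interval.1 hx).1

theorem interval_inter_part {i : Fin n} {j : ℕ} (hij : (i : ℕ) < j) (hπ : π ∈ ncOn n i j) :
    interval n i j ∩ π.part i = π.part i := by
  refine Finset.inter_eq_right.2 fun x hx => ?_
  rcases (mem_ncOn.1 hπ).2 i x hx with rfl | h
  · exact mem_interval.2 ⟨le_rfl, hij⟩
  · exact h.2

theorem IsSemicircularCumulant.nest_interval {X : A} (hf : IsSemicircularCumulant φ D X f)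
    {δ : Fin n → A} (hδ : ∀ j, δ j ∈ D) {i k : Fin n} {j : ℕ} (hik : i < k) (hkj : (k : ℕ) < j)
    (hπ : π ∈ ncOn n i j) (hp : HasPair π i k) :
    nest f π (fun j => X * δ j) (interval n i j) =
      φ (δ i * nest f (restrict π (i + 1) k) (fun j => X * δ j) (interval n (i + 1) k)) •
        (δ k * nest f (restrict π (k + 1) j) (fun j => X * δ j) (interval n (k + 1) j)) := by
  have hij : (i : ℕ) < j := lt_trans hik hkj
  have hV : interval n i j ∩ π.part ((interval n i j).min' (interval_nonempty hij)) = {i, k} := by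
    rw [min'_interval hij, interval_inter_part hij hπ]
    ext x
    rw [hp x, Finset.mem_insert, Finset.mem_singleton]
  have hg1 : gap (interval n i j) {i, k} i = interval n (i + 1) k := by
    ext x
    simp only [gap, Finset.mem_filter, mem_interval, Finset.mem_insert, Finset.mem_singleton,
      exists_eq_or_imp, forall_eq_or_imp, exists_eq_left, forall_eq, Fin.lt_def] at *
    omega
  -- Nothing follows the last point of a block in its gaps; the positions after `k` belong to the
  -- tail.
  have hg2 : gap (interval n i j) {i, k} k = ∅ := by
    ext x
    simp only [gap, Finset.mem_filter, mem_interval, Finset.mem_insert, Finset.mem_singleton,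
      exists_eq_or_imp, forall_eq_or_imp, exists_eq_left, forall_eq, Fin.lt_def,
      Finset.notMem_empty, iff_false] at *
    omega
  have ht : tail (interval n i j) {i, k} = interval n (k + 1) j := by
    ext x
    simp only [tail, Finset.mem_filter, mem_interval, Finset.mem_insert, Finset.mem_singleton,
      forall_eq_or_imp, forall_eq, Fin.lt_def] at *
    omega
  have hres : ∀ (b e : ℕ), nest f (restrict π b e) (fun j => X * δ j) (interval n b e) =
      nest f π (fun j => X * δ j) (interval n b e) := by
    intro b e
    refine nest_congr _ _ fun x hx => Finset.ext fun y => ?_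
    simp only [Finset.mem_inter, mem_part_restrict]
    constructor
    · rintro ⟨hy, rfl | h⟩
      · exact ⟨hy, mem_part_refl π x⟩
      · exact ⟨hy, h.2.2⟩
    · exact fun h => ⟨h.1, Or.inr ⟨hx, h.1, h.2⟩⟩
  rw [hf.nest_pair hδ (interval_nonempty hij) hik hV, hg1, hg2, ht, hres, hres, nest_empty, mul_one]

-- At most one term is nonzero, as a block `{i, k}` determines `k`. If the block of `i` is not a
-- pair, its functional vanishes and both sides are `0`.
open Classical in
theorem IsSemicircularCumulant.nest_interval_eq_sum {X : A} (hf : IsSemicircularCumulant φ D X f)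
    {δ : Fin n → A} (hδ : ∀ j, δ j ∈ D) {i : Fin n} {j : ℕ} (hij : (i : ℕ) < j)
    (hπ : π ∈ ncOn n i j) :
    nest f π (fun j => X * δ j) (interval n i j) =
      ∑ k ∈ interval n (i + 1) j, if HasPair π i k then
        φ (δ i * nest f (restrict π (i + 1) k) (fun j => X * δ j) (interval n (i + 1) k)) •
        (δ k * nest f (restrict π (k + 1) j) (fun j => X * δ j) (interval n (k + 1) j)) else 0 := by
  by_cases h : ∃ k ∈ interval n (i + 1) j, HasPair π i k
  · obtain ⟨k, hk, hp⟩ := h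
    rw [mem_interval] at hk
    rw [Finset.sum_eq_single k, if_pos hp, hf.nest_interval hδ (Fin.lt_def.2 hk.1) hk.2 hπ hp]
    · intro l hl hlk
      refine if_neg fun hpl => ?_
      rw [mem_interval] at hl
      rcases (hp l).1 ((hpl l).2 (Or.inr rfl)) with rfl | rfl
      · omega
      · exact hlk rfl
    · exact fun h => absurd (mem_interval.2 hk) h
  · push Not at h
    rw [Finset.sum_eq_zero fun k hk => if_neg (h k hk)]
    refine nest_eq_zero hδ hf.mem (interval_nonempty hij) fun b hb => ?_
    refine hf.other _ (Finset.card_pos.2 ⟨_, min'_mem_inter_part _⟩) (fun hc => ?_) b hb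
    rw [min'_interval hij, interval_inter_part hij hπ, Finset.card_eq_two] at hc
    obtain ⟨x, y, hxy, hc⟩ := hc
    have key : ∀ z, z ≠ i → π.part i = {i, z} → False := by
      intro z hz hc
      have hzi : z ∈ π.part i := by simp [hc]
      have hzI : z ∈ interval n i j := by
        rw [← interval_inter_part hij hπ] at hzi
        exact (Finset.mem_inter.1 hzi).1
      refine h z ?_ fun w => by simp [hc]
      rw [mem_interval] at *
      omega
    have hi := mem_part_refl π i
    rw [hc, Finset.mem_insert, Finset.mem_singleton] at hi
    rcases hi with rfl | rfl
    · exact key y hxy.symm hc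
    · exact key x hxy (by rw [hc, Finset.pair_comm])

/-- Sorting the partitions by the partner `k` of the first point, the factorization over pairs of
smaller partitions turns the sum into a sum of products, and linearity gives the recursion. -/
theorem IsSemicircularCumulant.isPairingSum {X : A} (hf : IsSemicircularCumulant φ D X f)
    {δ : ℕ → A} (hδ : ∀ j, δ j ∈ D) :
    IsPairingSum φ D δ n fun i j =>
      ∑ π ∈ ncOn n i j, nest f π (fun l => X * δ l) (interval n i j) := by
  refine ⟨fun i j => sum_mem fun π _ => nest_mem (δ := fun l : Fin n => δ l) (fun l => hδ l)
    hf.mem π _, fun i => ?_, fun i j hij hjn => ?_⟩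
  · have h : interval n i i = ∅ := by
      ext x
      simp only [mem_interval, Finset.notMem_empty, iff_false]
      omega
    simp [h, nest_empty, ncOn_self]
  · obtain ⟨i, rfl⟩ : ∃ i' : Fin n, (i' : ℕ) = i := ⟨⟨i, by omega⟩, rfl⟩
    have himg : ∑ k ∈ Finset.Ico ((i : ℕ) + 1) j,
        φ (δ i * ∑ π ∈ ncOn n (i + 1) k, nest f π (fun l => X * δ l) (interval n (i + 1) k)) •
          (δ k * ∑ π ∈ ncOn n (k + 1) j, nest f π (fun l => X * δ l) (interval n (k + 1) j)) =
        ∑ k ∈ interval n (i + 1) j,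
        φ (δ i * ∑ π ∈ ncOn n (i + 1) k, nest f π (fun l => X * δ l) (interval n (i + 1) k)) •
          (δ k * ∑ π ∈ ncOn n (k + 1) j, nest f π (fun l => X * δ l) (interval n (k + 1) j)) := by
      symm
      refine Finset.sum_bij (fun k _ => (k : ℕ)) (fun k hk => ?_) (fun _ _ _ _ h => Fin.ext h)
        (fun k hk => ?_) fun _ _ => rfl
      · rw [mem_interval] at hk; exact Finset.mem_Ico.2 hk
      · rw [Finset.mem_Ico] at hk
        exact ⟨⟨k, by omega⟩, mem_interval.2 hk, rfl⟩
    rw [himg, Finset.sum_congr rfl fun π hπ =>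
      hf.nest_interval_eq_sum (δ := fun l : Fin n => δ l) (fun l => hδ l) hij hπ, Finset.sum_comm]
    refine Finset.sum_congr rfl fun k hk => ?_
    rw [mem_interval] at hk
    rw [← Finset.sum_filter, sum_hasPair (Fin.lt_def.2 hk.1) hk.2 fun σ τ =>
      φ (δ i * nest f σ (fun l : Fin n => X * δ l) (interval n (i + 1) k)) •
        (δ k * nest f τ (fun l : Fin n => X * δ l) (interval n (k + 1) j))]
    simp only [Finset.mul_sum, map_sum, Finset.sum_smul, Finset.smul_sum]
    rw [Finset.sum_comm]

end Nest

/-! ### Identification of the cumulants -/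

section Cumulants

variable {A : Type*} [Ring A] [Algebra ℂ A] {φ : A →ₗ[ℂ] ℂ} {D : Subalgebra ℂ A}

-- The moment equals the sum over all noncrossing partitions for the functionals truncated below
-- `n`. The definition of the cumulant subtracts the same sum without the one-block partition, whose
-- term is zero since the truncated functional of order `n > 2` is.
open Classical in
theorem cumulant_eq_zero {E : A →ₗ[ℂ] A} {X : A} {n : ℕ} (hn : 2 < n) {δ : ℕ → A}
    (hδ : ∀ j, δ j ∈ D)
    (hf : IsSemicircularCumulant φ D X fun m b => if _h : m < n then cumulant E m b else 0)
    (hE : ∀ S, IsPairingSum φ D δ n S → E (List.ofFn fun j : Fin n => X * δ j).prod = S 0 n) :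
    cumulant E n (fun j => X * δ j) = 0 := by
  rw [cumulant, hE _ (hf.isPairingSum hδ), sub_eq_zero]
  have huniv : interval n 0 n = Finset.univ := Finset.ext fun x => by simp [mem_interval]
  rw [huniv]
  symm
  refine Finset.sum_subset (fun π hπ => ?_) fun π hπ hπ' => ?_
  · rw [Finset.mem_filter] at hπ
    exact mem_ncOn.2 ⟨hπ.2.1, fun x y _ => Or.inr ⟨by simp [huniv], by simp [huniv]⟩⟩
  · have hparts : Finset.univ ∈ π.parts := by
      by_contra h
      exact hπ' (Finset.mem_filter.2 ⟨Finset.mem_univ π, (mem_ncOn.1 hπ).1, h⟩)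
    have hs : (Finset.univ : Finset (Fin n)).Nonempty := ⟨⟨0, by omega⟩, Finset.mem_univ _⟩
    have hcard : (Finset.univ ∩ π.part (Finset.univ.min' hs)).card = n := by
      rw [π.part_eq_of_mem hparts (Finset.mem_univ _), Finset.inter_self, Finset.card_univ,
        Fintype.card_fin]
    exact nest_eq_zero (D := D) (δ := fun j : Fin n => δ j) (fun j => hδ j) hf.mem hs
      fun b hb => hf.other _ (by omega) (by omega) b hb

/-- Every subtracted term contains the functional of the first block, which vanishes: by hypothesis
below order `n`, by truncation from order `n` on. This handles the orders `1` and `2`. -/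
theorem cumulant_eq_moment {E : A →ₗ[ℂ] A} {X : A} {n : ℕ} (hn : 1 ≤ n) {δ : Fin n → A}
    (hδ : ∀ j, δ j ∈ D) (h0 : ∀ m < n, 1 ≤ m → ∀ b : Fin m → A, (∀ j, b j ∈ D) →
      cumulant E m (fun j => X * b j) = 0) :
    cumulant E n (fun j => X * δ j) = E (List.ofFn fun j => X * δ j).prod := by
  rw [cumulant, sub_eq_self]
  refine Finset.sum_eq_zero fun π _ => ?_
  have hf : ∀ m, 1 ≤ m → ∀ b : Fin m → A, (∀ j, b j ∈ D) →
      (fun (m : ℕ) (b : Fin m → A) => if _h : m < n then cumulant E m b else 0) m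
        (fun j => X * b j) = 0 := by
    intro m hm b hb
    by_cases h : m < n
    · simp only [dif_pos h]; exact h0 m h hm b hb
    · simp only [dif_neg h]
  have hs : (Finset.univ : Finset (Fin n)).Nonempty := ⟨⟨0, by omega⟩, Finset.mem_univ _⟩
  exact nest_eq_zero hδ (fun m hm b hb => by
    have h := hf m hm b hb
    dsimp only at h
    rw [h]; exact zero_mem D) hs
    fun b hb => hf _ (Finset.card_pos.2 ⟨_, min'_mem_inter_part _⟩) b hb

/-- Up to length two the pairing sums are explicit. The values with `j < i` or `j > i + 2` never
enter the recursion. -/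
theorem exists_isPairingSum {n : ℕ} (hn : n ≤ 2) {δ : ℕ → A} (hδ : ∀ j, δ j ∈ D) :
    ∃ S, IsPairingSum φ D δ n S ∧ S 0 1 = 0 ∧ S 0 2 = φ (δ 0) • δ 1 := by
  refine ⟨fun i j => if j ≤ i then 1 else if j = i + 1 then 0 else φ (δ i) • δ (i + 1),
    ⟨fun i j => ?_, fun i => by simp, fun i j hij hj => ?_⟩, by simp, by simp⟩
  · split_ifs
    · exact one_mem D
    · exact zero_mem D
    · exact D.smul_mem (hδ _) _
  · rcases (show j = i + 1 ∨ j = i + 2 by omega) with rfl | rfl <;> simp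

/-- The moment hypothesis holds for every solution `S` of the recursion, so the solution can be
chosen by order: explicit for `n ≤ 2`, and for `n > 2` the nested sums of the lower cumulants, which
are semicircular by strong induction. -/
theorem isSemicircularCumulant_cumulant {E : A →ₗ[ℂ] A} {X : A}
    (hE : ∀ (n : ℕ) (δ : ℕ → A), (∀ j, δ j ∈ D) → ∀ S, IsPairingSum φ D δ n S →
      E (List.ofFn fun j : Fin n => X * δ j).prod = S 0 n) :
    IsSemicircularCumulant φ D X (cumulant E) := by
  -- Finite tuples are extended by `0` to sequences on `ℕ`, the form in which the pairing recursion
  -- is stated.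
  let ext : ∀ {m : ℕ}, (Fin m → A) → ℕ → A := fun {m} b k => if h : k < m then b ⟨k, h⟩ else 0
  have hext : ∀ {m : ℕ} (b : Fin m → A) (j : Fin m), ext b j = b j := fun b j => by simp [ext]
  have hmem : ∀ {m : ℕ} (b : Fin m → A), (∀ j, b j ∈ D) → ∀ k, ext b k ∈ D := by
    intro m b hb k
    simp only [ext]
    split_ifs
    · exact hb _
    · exact zero_mem D
  have h1 : ∀ b : Fin 1 → A, (∀ j, b j ∈ D) → cumulant E 1 (fun j => X * b j) = 0 := by
    intro b hb
    obtain ⟨S, hS, hS1, -⟩ := exists_isPairingSum (φ := φ) (n := 1) (by simp) (hmem b hb)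
    have h := hE 1 (ext b) (hmem b hb) S hS
    simp only [hext] at h
    rw [cumulant_eq_moment (D := D) le_rfl hb (fun m h h' => by omega), h, hS1]
  have h2 : ∀ b : Fin 2 → A, (∀ j, b j ∈ D) →
      cumulant E 2 (fun j => X * b j) = φ (b 0) • b 1 := by
    intro b hb
    obtain ⟨S, hS, -, hS2⟩ := exists_isPairingSum (φ := φ) (n := 2) (by simp) (hmem b hb)
    have h := hE 2 (ext b) (hmem b hb) S hS
    simp only [hext] at h
    rw [cumulant_eq_moment (D := D) (by simp) hb, h, hS2]
    · simp [ext]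
    · intro m hm hm1
      obtain rfl : m = 1 := by omega
      exact h1
  refine ⟨h2, fun m => ?_⟩
  induction m using Nat.strong_induction_on with
  | _ n ih =>
  intro hn hn2 b hb
  rcases (show n = 1 ∨ 2 < n by omega) with rfl | hn3
  · exact h1 b hb
  · have h := cumulant_eq_zero (φ := φ) (E := E) (X := X) hn3 (hmem b hb) ⟨fun c hc => ?_,
      fun m hm hm2 c hc => ?_⟩ (hE n _ (hmem b hb))
    · simpa only [hext] using h
    · exact (dif_pos hn3).trans (h2 c hc)
    · by_cases hmn : m < n
      · exact (dif_pos hmn).trans (ih m hmn hm hm2 c hc)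
      · exact dif_neg hmn

theorem condExp_ofFn {I : Type*} {F : Option I → Subalgebra ℂ A} {d : ℕ} {p : Fin d → A}
    (h1 : φ 1 = 1) (htr : ∀ a b, φ (a * b) = φ (b * a)) (hp : CompleteOrthogonalIdempotents p)
    (hρ : ∀ k, φ (p k) ≠ 0) (hF : AlternatingVanish φ F) (hD : diagAlg hp ≤ F none) {s : I}
    {X : A} (hXF : X ∈ F (some s))
    (hX : ∀ m : ℕ, φ (Polynomial.aeval X (Polynomial.Chebyshev.S ℂ ((m + 1 : ℕ) : ℤ))) = 0)
    (n : ℕ) (δ : ℕ → A) (hδ : ∀ j, δ j ∈ diagAlg hp) (S : ℕ → ℕ → A)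
    (hS : IsPairingSum φ (diagAlg hp) δ n S) :
    condExp φ p (List.ofFn fun j : Fin n => X * δ j).prod = S 0 n := by
  refine condExp_word (w := fun i => ((List.ofFn fun j : Fin n => X * δ j).drop i).prod)
    h1 htr hp hρ hF hD hS hδ hXF hX ?_ fun i hi => ?_
  · rw [List.drop_eq_nil_of_le (by simp), List.prod_nil]
  · rw [List.drop_eq_getElem_cons (by simpa using hi), List.prod_cons, List.getElem_ofFn, mul_assoc]

end Cumulants

end RectFree
end

/-! ### The theorem -/

theorem mainTheorem3 {A : Type*} [Ring A] [StarRing A] [Algebra ℂ A] [StarModule ℂ A]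
    (φ : A →ₗ[ℂ] ℂ) (hφ : RectFree.IsTracialState φ)
    {d : ℕ} (p : Fin d → A) (hp : CompleteOrthogonalIdempotents p)
    (hpsa : ∀ k, IsSelfAdjoint (p k)) (hρ : ∀ k, φ (p k) ≠ 0)
    (y : ℕ → A) (hy : ∀ s, RectFree.IsSemicircular φ (y s))
    (B : Subalgebra ℂ A) (hB : RectFree.diag p ≤ Subalgebra.toSubmodule B)
    (hfree : RectFree.IsFree φ
      (fun o : Option ℕ => o.elim (B : Set A) fun s => ({y s} : Set A))) :
    RectFree.IsFreeOver φ p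
        (fun o : Option ℕ => o.elim (B : Set A) fun s => ({y s} : Set A)) ∧
      ∀ s, RectFree.IsDSemicircular φ p (y s) := by
  obtain ⟨F, hχ, hF⟩ := hfree
  have hD : RectFree.diagAlg hp ≤ F none := fun x hx => hχ none (hB hx)
  have hyF : ∀ s, y s ∈ F (some s) := fun s => hχ (some s) rfl
  refine ⟨⟨fun i => RectFree.diagAlg hp ⊔ F i, fun i x hx =>
    (le_sup_left : RectFree.diagAlg hp ≤ RectFree.diagAlg hp ⊔ F i) hx, fun i x hx =>
    (le_sup_right : F i ≤ RectFree.diagAlg hp ⊔ F i) (hχ i hx),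
    RectFree.alternatingVanish_condExp hφ.map_one hφ.trace hp hρ hF hD⟩, fun s => ?_⟩
  have hc : RectFree.IsSemicircularCumulant φ (RectFree.diagAlg hp) (y s)
      (RectFree.cumulant (RectFree.condExp φ p)) :=
    RectFree.isSemicircularCumulant_cumulant fun n δ hδ S hS =>
      RectFree.condExp_ofFn hφ.map_one hφ.trace hp hρ hF hD (hyF s) (hy s).apply_chebyshev n δ hδ S hS
  refine ⟨(hy s).1, ?_, fun δ hδ => ?_, fun k hk δ hδ => hc.other k (by omega) (by omega) δ hδ⟩
  · have h := hc.other 1 le_rfl (by simp) (fun _ => 1) fun _ => one_mem _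
    have he : (fun _ : Fin 1 => y s * 1) = ![y s] := by
      funext j; fin_cases j; simp
    rwa [he] at h
  -- The second argument of the covariance carries no coefficient, so its weight is `1` and `φ (b 0)
  -- • b 1` becomes the scalar `φ δ`.
  · have h := hc.two ![δ, 1] fun j => by
      fin_cases j
      · exact hδ
      · exact one_mem (RectFree.diagAlg hp)
    have he : (fun j : Fin 2 => y s * ![δ, 1] j) = ![y s * δ, y s] := by
      funext j; fin_cases j <;> simp
    rw [he] at h
    simpa [Algebra.algebraMap_eq_smul_one] using h
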